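/- For $N\in\mathbb N$ let $[N]=\{1,\dots,N\}$. A string $j_1\cdots j_\ell$ over $[N]$ is *alternating* if $j_i\ne j_{i+1}$ for all $i$. Let $\mathcal T_{N,\mathrm{free}}$ be the graph whose vertices are the alternating strings over $[N]$, with an edge between $s$ and $js$ whenever $s$ and $js$ are alternating, rooted at the empty string $\emptyset$. Let $\mathrm{Tree}(N)$ be the set of connected subgraphs $\mathcal T$ of $\mathcal T_{N,\mathrm{free}}$ containing $\emptyset$, identified with their vertex sets, with the metric $\rho_N(\mathcal T,\mathcal T')=\exp(-\sup\{\ell\ge 0: \mathcal T \text{ and } \mathcal T' \text{ contain the same strings of length}\le \ell\})$ (where $\exp(-\infty)=0$). For $j\in[N]\cap\mathcal T$ let $\mathrm{br}_j(\mathcal T)=\{s: sj\in\mathcal T\}\in\mathrm{Tree}(N)$. Let $\mathcal P(\mathbb R)$ be the set of Borel probability measures on $\mathbb R$ with the weak (equivalently vague) topology, and for $\mu\in\mathcal P(\mathbb R)$ and $\operatorname{Im}z>0$ put $G_\mu(z)=\int_{\mathbb R}\frac{d\mu(t)}{z-t}$ and $K_\mu(z)=z-1/G_\mu(z)$. The *tree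 convolution* is the function $\mathrm{Tree}(N)\times\mathcal P(\mathbb R)^N\to\mathcal P(\mathbb R)$, $(\mathcal T,\mu_1,\dots,\mu_N)\mapsto\boxplus_{\mathcal T}(\mu_1,\dots,\mu_N)$, that is continuous in $\mathcal T$ and satisfies, for all $\mathcal T$, all $\mu_1,\dots,\mu_N$ and all $z$ with $\operatorname{Im}z>0$, $$K_{\boxplus_{\mathcal T}(\mu_1,\dots,\mu_N)}(z)=\sum_{j\in[N]\cap\mathcal T}K_{\mu_j}\bigl(z-K_{\boxplus_{\mathrm{br}_j(\mathcal T)}(\mu_1,\dots,\mu_N)}(z)\bigr).$$ **Proposition.** (0) For every $N$ there is exactly one function with these two properties, so the tree convolution is well defined. (1) Let $\psi:[N]\to[N']$ be surjective, and write $\psi_*(j_1\cdots j_\ell)=\psi(j_1)\cdots\psi(j_\ell)$. Let $\mathcal T\in\mathrm{Tree}(N)$ be such that $\psi_*(s)$ is alternating for every $s\in\mathcal T$ and $\psi_*$ is injective on $\mathcal T$, and let $\psi_*(\mathcal T)=\{\psi_*(s):s\in\mathcal T\}\in\mathrm{Tree}(N')$. Then for all $\mu_1,\dots,\mu_{N'}\in\mathcal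 P(\mathbb R)$, $$\boxplus_{\mathcal T}(\mu_{\psi(1)},\dots,\mu_{\psi(N)})=\boxplus_{\psi_*(\mathcal T)}(\mu_1,\dots,\mu_{N'}).$$ (2) In particular the convolution is permutation-equivariant: for every permutation $\sigma$ of $[N]$, every $\mathcal T\in\mathrm{Tree}(N)$ and all $\mu_1,\dots,\mu_N\in\mathcal P(\mathbb R)$, with $\mathcal T_\sigma=\{(\sigma^{-1})_*(s):s\in\mathcal T\}$, $$\boxplus_{\mathcal T_\sigma}(\mu_{\sigma(1)},\dots,\mu_{\sigma(N)})=\boxplus_{\mathcal T}(\mu_1,\dots,\mu_N).$$ -/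

import Mathlib

open MeasureTheory

noncomputable section

namespace TreeConvolution

/-! ### Cauchy transforms -/

/-- The Cauchy-Stieltjes transform `G_μ(z) = ∫ 1 / (z - t) dμ(t)`. -/
def cauchyTransform (μ : ProbabilityMeasure ℝ) (z : ℂ) : ℂ :=
  ∫ t : ℝ, 1 / (z - (t : ℂ)) ∂(μ : Measure ℝ)

/-- The `F`-transform `F_μ(z) = 1 / G_μ(z)`. -/
def fTransform (μ : ProbabilityMeasure ℝ) (z : ℂ) : ℂ :=
  1 / cauchyTransform μ z

/-- The `K`-transform `K_μ(z) = z - F_μ(z)`. -/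
def kTransform (μ : ProbabilityMeasure ℝ) (z : ℂ) : ℂ :=
  z - fTransform μ z

/-! ### Rooted trees of alternating strings

The alphabet `[N]` is `Fin N`; the string `j₁ … j_ℓ` is the list `[j₁, …, j_ℓ]`. -/

/-- A string is alternating if consecutive letters are distinct. -/
def IsAlternating {N : ℕ} (s : List (Fin N)) : Prop :=
  s.IsChain (· ≠ ·)

/-- The graph `𝒯_{N,free}`: `s ∼ j s` whenever `s` and `j s` are alternating. (Its vertices are the
alternating strings; the other strings are only present as isolated points, and a `RootedTree`
does not contain any.) -/
def freeTree (N : ℕ) : SimpleGraph (List (Fin N)) where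
  Adj s t := IsAlternating s ∧ IsAlternating t ∧ ((∃ j, t = j :: s) ∨ (∃ j, s = j :: t))
  symm := ⟨fun _ _ h => ⟨h.2.1, h.1, h.2.2.symm⟩⟩
  loopless := ⟨fun s h => by
    rcases h.2.2 with ⟨j, hj⟩ | ⟨j, hj⟩ <;> simpa using congrArg List.length hj⟩

/-- `Tree(N)`: connected subgraphs of `𝒯_{N,free}` that contain the root `∅`. As
`𝒯_{N,free}` is a tree, such a subgraph is the induced subgraph on its vertex set, so it is
recorded as a set of vertices. -/
@[ext]
structure RootedTree (N : ℕ) where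
  /-- the set of vertices -/
  verts : Set (List (Fin N))
  alternating : ∀ s ∈ verts, IsAlternating s
  root_mem : [] ∈ verts
  connected : ((freeTree N).induce verts).Connected

namespace RootedTree

variable {N N' : ℕ}

/-- The parent of a vertex of a rooted tree is a vertex. -/
theorem parent_mem (T : RootedTree N) {j : Fin N} {s : List (Fin N)} (h : j :: s ∈ T.verts) :
    s ∈ T.verts := by
  by_contra hs
  have key : ∀ t : T.verts, ((freeTree N).induce T.verts).Reachable ⟨[], T.root_mem⟩ t →
      ¬ (j :: s <:+ t.1) := by
    intro t ht
    rw [SimpleGraph.reachable_iff_reflTransGen] at ht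
    induction ht with
    | refl => simp
    | @tail b c _ hbc ih =>
      intro hc
      rcases hbc.2.2 with ⟨i, hi⟩ | ⟨i, hi⟩
      · have hi' : c.1 = i :: b.1 := hi
        rw [hi', List.suffix_cons_iff] at hc
        rcases hc with hc | hc
        · simp only [List.cons.injEq] at hc
          exact hs (hc.2 ▸ b.2)
        · exact ih hc
      · have hi' : b.1 = i :: c.1 := hi
        exact ih (hi' ▸ hc.trans (List.suffix_cons i c.1))
  exact key ⟨_, h⟩ (T.connected.preconnected _ _) List.suffix_rfl

/-- A set of alternating strings that contains `∅` and is closed under taking parents is (the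
vertex set of) a rooted tree. -/
def ofParentClosed (V : Set (List (Fin N))) (halt : ∀ s ∈ V, IsAlternating s) (hroot : [] ∈ V)
    (hparent : ∀ (j : Fin N) (s : List (Fin N)), j :: s ∈ V → s ∈ V) : RootedTree N where
  verts := V
  alternating := halt
  root_mem := hroot
  connected := by
    have key : ∀ (s : List (Fin N)) (hs : s ∈ V),
        ((freeTree N).induce V).Reachable ⟨[], hroot⟩ ⟨s, hs⟩ := by
      intro s
      induction s with
      | nil => intro hs; exact SimpleGraph.Reachable.refl _
      | cons j s ih =>
        intro hs
        refine (ih (hparent j s hs)).trans (SimpleGraph.Adj.reachable ?_)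
        exact ⟨halt _ (hparent j s hs), halt _ hs, Or.inl ⟨j, rfl⟩⟩
    have : Nonempty V := ⟨⟨[], hroot⟩⟩
    exact ⟨fun a b => (key a.1 a.2).symm.trans (key b.1 b.2)⟩

/-- `B_ℓ(T)`: the strings in `T` of length at most `ℓ`. -/
def ball (T : RootedTree N) (l : ℕ) : Set (List (Fin N)) :=
  {s | s ∈ T.verts ∧ s.length ≤ l}

/-- The levels up to which two trees agree. -/
def agreeLevels (T T' : RootedTree N) : Set ℕ :=
  {l | T.ball l = T'.ball l}

open Classical in
/-- `ρ_N(T, T') = exp (- sup {ℓ ≥ 0 : B_ℓ(T) = B_ℓ(T')})`, where `exp (-∞) = 0`; the supremum is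
infinite exactly when `T = T'`. -/
def rho (T T' : RootedTree N) : ℝ :=
  if T = T' then 0 else Real.exp (-((sSup (agreeLevels T T') : ℕ) : ℝ))

theorem agreeLevels_nonempty (T T' : RootedTree N) : (agreeLevels T T').Nonempty := by
  refine ⟨0, ?_⟩
  ext s
  simp only [ball, Set.mem_ofPred_eq, Nat.le_zero, List.length_eq_zero_iff]
  constructor
  · rintro ⟨_, rfl⟩; exact ⟨T'.root_mem, rfl⟩
  · rintro ⟨_, rfl⟩; exact ⟨T.root_mem, rfl⟩

theorem agreeLevels_mono {T T' : RootedTree N} {k l : ℕ} (hkl : k ≤ l)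
    (h : l ∈ agreeLevels T T') : k ∈ agreeLevels T T' := by
  ext s
  have hs := Set.ext_iff.1 h s
  simp only [ball, Set.mem_ofPred_eq] at hs ⊢
  constructor
  · rintro ⟨h1, h2⟩; exact ⟨(hs.1 ⟨h1, h2.trans hkl⟩).1, h2⟩
  · rintro ⟨h1, h2⟩; exact ⟨(hs.2 ⟨h1, h2.trans hkl⟩).1, h2⟩

theorem agreeLevels_bddAbove {T T' : RootedTree N} (h : T ≠ T') :
    BddAbove (agreeLevels T T') := by
  by_contra hb
  apply h
  ext s
  rw [not_bddAbove_iff] at hb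
  obtain ⟨l, hl, hsl⟩ := hb s.length
  have hs := Set.ext_iff.1 hl s
  simp only [ball, Set.mem_ofPred_eq] at hs
  exact ⟨fun h1 => (hs.1 ⟨h1, hsl.le⟩).1, fun h1 => (hs.2 ⟨h1, hsl.le⟩).1⟩

theorem rho_nonneg (T T' : RootedTree N) : 0 ≤ rho T T' := by
  unfold rho; split_ifs
  · exact le_rfl
  · exact (Real.exp_pos _).le

theorem rho_ultra (T T' T'' : RootedTree N) : rho T T'' ≤ max (rho T T') (rho T' T'') := by
  by_cases h1 : T = T'
  · subst h1; exact le_max_right _ _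
  by_cases h2 : T' = T''
  · subst h2; exact le_max_left _ _
  by_cases h3 : T = T''
  · exact le_trans (by simp [rho, h3]) (le_max_of_le_left (rho_nonneg _ _))
  have e1 := Nat.sSup_mem (agreeLevels_nonempty T T') (agreeLevels_bddAbove h1)
  have e2 := Nat.sSup_mem (agreeLevels_nonempty T' T'') (agreeLevels_bddAbove h2)
  have e3 : min (sSup (agreeLevels T T')) (sSup (agreeLevels T' T'')) ∈ agreeLevels T T'' :=
    Eq.trans (agreeLevels_mono (min_le_left _ _) e1) (agreeLevels_mono (min_le_right _ _) e2)
  have e4 := le_csSup (agreeLevels_bddAbove h3) e3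
  simp only [rho, h1, h2, h3, if_false, le_max_iff, Real.exp_le_exp, neg_le_neg_iff, Nat.cast_le]
  exact min_le_iff.1 e4

/-- The metric (and with it the topology) of `Tree(N)`. -/
instance : MetricSpace (RootedTree N) where
  dist := rho
  dist_self T := by simp [rho]
  dist_comm T T' := by
    have h : agreeLevels T T' = agreeLevels T' T := by
      ext l; exact eq_comm
    by_cases hT : T = T'
    · rw [hT]
    · simp only [rho, h, hT, Ne.symm hT, if_false]
  dist_triangle T T' T'' := (rho_ultra T T' T'').trans
    (max_le_add_of_nonneg (rho_nonneg _ _) (rho_nonneg _ _))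
  eq_of_dist_eq_zero {T T'} h := by
    by_contra hne
    have h' : rho T T' = 0 := h
    simp [rho, hne, Real.exp_ne_zero] at h'

/-- The branch `br_j(T) = {s : s j ∈ T}` for `j ∈ [N] ∩ T`. -/
def branch (T : RootedTree N) (j : Fin N) (hj : [j] ∈ T.verts) : RootedTree N :=
  ofParentClosed {s | s ++ [j] ∈ T.verts}
    (fun _ hs => (List.isChain_append.1 (T.alternating _ hs)).1)
    hj
    (fun _ _ hs => T.parent_mem hs)

/-- The image `ψ_*(T)`, where `ψ_*` applies `ψ` to every letter of a string, provided that
`ψ_*(s)` is alternating for every `s ∈ T`. -/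
def map (T : RootedTree N) (ψ : Fin N → Fin N')
    (h : ∀ s ∈ T.verts, IsAlternating (s.map ψ)) : RootedTree N' :=
  ofParentClosed (List.map ψ '' T.verts)
    (by rintro _ ⟨s, hs, rfl⟩; exact h s hs)
    ⟨[], T.root_mem, rfl⟩
    (by
      rintro j t ⟨s, hs, hst⟩
      cases s with
      | nil => simp at hst
      | cons i s =>
        simp only [List.map_cons, List.cons.injEq] at hst
        exact ⟨s, T.parent_mem hs, hst.2⟩)

/-- `Tree(ψ)`: the trees `T` such that `ψ_*(s)` is alternating for every `s ∈ T` and `ψ_*` is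
injective on `T`. -/
structure Compatible (T : RootedTree N) (ψ : Fin N → Fin N') : Prop where
  alternating : ∀ s ∈ T.verts, IsAlternating (s.map ψ)
  injOn : Set.InjOn (List.map ψ) T.verts

/-- The right action of the permutation group: `T_σ = {σ⁻¹(s) : s ∈ T}`, where `σ⁻¹` is applied to
every letter. -/
def perm (T : RootedTree N) (σ : Equiv.Perm (Fin N)) : RootedTree N :=
  T.map (σ⁻¹ : Equiv.Perm (Fin N)) (fun s hs => by
    unfold IsAlternating
    rw [List.isChain_map]
    exact (T.alternating s hs).imp fun a b hab => (σ⁻¹ : Equiv.Perm (Fin N)).injective.ne hab)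

end RootedTree

/-! ### Convolution over a tree -/

open Classical in
/-- The defining property of the tree convolution: `conv` is continuous in the tree, and
`K_{conv T μ}(z) = ∑_{j ∈ [N] ∩ T} K_{μ_j}(z - K_{conv (br_j T) μ}(z))` on the upper half-plane.
`ProbabilityMeasure ℝ` carries the topology of weak convergence, which on probability measures
is the vague topology. -/
structure IsTreeConvolution {N : ℕ}
    (conv : RootedTree N → (Fin N → ProbabilityMeasure ℝ) → ProbabilityMeasure ℝ) : Prop where
  continuous : ∀ μ : Fin N → ProbabilityMeasure ℝ, Continuous fun T => conv T μ
  fixedPoint : ∀ (T : RootedTree N) (μ : Fin N → ProbabilityMeasure ℝ) (z : ℂ), 0 < z.im →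
    kTransform (conv T μ) z =
      ∑ j : Fin N, if hj : [j] ∈ T.verts then
        kTransform (μ j) (z - kTransform (conv (T.branch j hj) μ) z) else 0

/-- The tree convolution `⊞_T(μ_1, …, μ_N)`: the function with the property
`IsTreeConvolution`. -/
def treeConv {N : ℕ} : RootedTree N → (Fin N → ProbabilityMeasure ℝ) → ProbabilityMeasure ℝ :=
  Classical.epsilon IsTreeConvolution

end TreeConvolution

end

noncomputable section

namespace TreeConvolution

open Filter Topology Complex

/-! ### Basic properties of the Cauchy transform -/

/-! Existence is a contraction argument high up in the half-plane. On a truncated cone `K_μ(w)` is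
`o(|w|)` and has a small Lipschitz constant once the cone is cut off high enough
(`eventually_norm_kTransform_le`, `eventually_norm_kTransform_sub_le`). Iterate the recursion from
`K = 0`. For finitely many `μ_j`, one cone works for all depths and all trees, and there each step
at least halves distances. So approximations of depth at least `m`, over trees agreeing up to length
`m`, differ by at most `2^(-m) * 2 Im z` (`eventually_norm_kTransform_approx_sub_le`). This one
estimate yields both convergence of the iteration and continuity in the tree.

Two facts connect this to measures. Every iterate is a `K`-transform, because `z - ∑ K_{μ_j}(…)` is
holomorphic, does not lower imaginary parts and is asymptotic to `z` along the imaginary axis; such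
functions are `F`-transforms (`exists_fTransform_eq`, through the Poisson formula). And convergence
of `K` near one point, with the uniform bound `K(iy) = o(y)` for tightness, gives weak convergence,
since the Cauchy transform near a point determines the measure.

The identities need only the two defining properties. For trees of bounded height, induct through
the fixed point equation: `ψ` matches the first-level letters of `T` bijectively with those of its
image, and branches commute with `ψ_*`. Truncations converge to the tree, so continuity gives the
general case (`IsTreeConvolution.map_eq`). Uniqueness is the case `ψ = id`, and equivariance the
case `ψ = σ⁻¹`. -/

theorem sub_ofReal_ne_zero {z : ℂ} (hz : 0 < z.im) (t : ℝ) : z - (t : ℂ) ≠ 0 := by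
  intro h
  have := congrArg Complex.im h
  simp at this
  linarith

theorem im_le_norm_sub_ofReal (z : ℂ) (t : ℝ) : z.im ≤ ‖z - (t : ℂ)‖ := by
  simpa using (le_abs_self _).trans (Complex.abs_im_le_norm (z - (t : ℂ)))

theorem norm_one_div_sub_ofReal_le {z : ℂ} (hz : 0 < z.im) (t : ℝ) :
    ‖1 / (z - (t : ℂ))‖ ≤ 1 / z.im := by
  rw [norm_div, norm_one]
  exact one_div_le_one_div_of_le hz (im_le_norm_sub_ofReal z t)

theorem continuous_one_div_sub_ofReal {z : ℂ} (hz : 0 < z.im) :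
    Continuous fun t : ℝ => 1 / (z - (t : ℂ)) :=
  continuous_const.div (continuous_const.sub continuous_ofReal) (sub_ofReal_ne_zero hz)

theorem integrable_one_div_sub_ofReal (μ : ProbabilityMeasure ℝ) {z : ℂ} (hz : 0 < z.im) :
    Integrable (fun t : ℝ => 1 / (z - (t : ℂ))) (μ : Measure ℝ) :=
  Integrable.of_bound (continuous_one_div_sub_ofReal hz).aestronglyMeasurable (1 / z.im)
    (ae_of_all _ (norm_one_div_sub_ofReal_le hz))

theorem normSq_sub_ofReal (z : ℂ) (t : ℝ) :
    Complex.normSq (z - (t : ℂ)) = (z.re - t) ^ 2 + z.im ^ 2 := by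
  rw [Complex.normSq_apply]; simp; ring

theorem im_one_div_sub_ofReal (z : ℂ) (t : ℝ) :
    (1 / (z - (t : ℂ))).im = -(z.im / ((z.re - t) ^ 2 + z.im ^ 2)) := by
  rw [one_div, Complex.inv_im, normSq_sub_ofReal]; simp [neg_div]

theorem neg_im_cauchyTransform (μ : ProbabilityMeasure ℝ) {z : ℂ} (hz : 0 < z.im) :
    -(cauchyTransform μ z).im = ∫ t : ℝ, z.im / ((z.re - t) ^ 2 + z.im ^ 2) ∂(μ : Measure ℝ) := by
  have h := Complex.imCLM.integral_comp_comm (integrable_one_div_sub_ofReal μ hz)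
  simp only [Complex.imCLM_apply, im_one_div_sub_ofReal, integral_neg] at h
  rw [cauchyTransform, ← h, neg_neg]

theorem integrable_poisson (μ : ProbabilityMeasure ℝ) {z : ℂ} (hz : 0 < z.im) :
    Integrable (fun t : ℝ => z.im / ((z.re - t) ^ 2 + z.im ^ 2)) (μ : Measure ℝ) := by
  have h := Complex.imCLM.integrable_comp (integrable_one_div_sub_ofReal μ hz)
  simp only [Complex.imCLM_apply, im_one_div_sub_ofReal] at h
  simpa using h.neg

theorem im_cauchyTransform_neg (μ : ProbabilityMeasure ℝ) {z : ℂ} (hz : 0 < z.im) :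
    (cauchyTransform μ z).im < 0 := by
  rw [← neg_pos, neg_im_cauchyTransform μ hz]
  have hpos : ∀ t : ℝ, 0 < z.im / ((z.re - t) ^ 2 + z.im ^ 2) := fun t => by positivity
  rw [integral_pos_iff_support_of_nonneg (fun t => (hpos t).le) (integrable_poisson μ hz)]
  have : Function.support (fun t : ℝ => z.im / ((z.re - t) ^ 2 + z.im ^ 2)) = Set.univ :=
    Set.eq_univ_of_forall fun t => (hpos t).ne'
  rw [this, measure_univ]
  exact one_pos

theorem cauchyTransform_ne_zero (μ : ProbabilityMeasure ℝ) {z : ℂ} (hz : 0 < z.im) :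
    cauchyTransform μ z ≠ 0 := by
  intro h
  have := im_cauchyTransform_neg μ hz
  simp [h] at this

theorem norm_cauchyTransform_le (μ : ProbabilityMeasure ℝ) {z : ℂ} (hz : 0 < z.im) :
    ‖cauchyTransform μ z‖ ≤ 1 / z.im := by
  have h := norm_integral_le_of_norm_le_const (μ := (μ : Measure ℝ))
    (ae_of_all _ (norm_one_div_sub_ofReal_le hz))
  simpa [cauchyTransform] using h

/-- For `c > 0`, `c ‖u‖ ^ 2 ≤ - Im u` describes a disc tangent to the real axis at `0`. -/
theorem norm_add_I_div_le_iff {c : ℝ} (hc : 0 < c) (u : ℂ) :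
    ‖u + I / (2 * c)‖ ≤ 1 / (2 * c) ↔ c * Complex.normSq u ≤ -u.im := by
  have h1 : ‖u + I / (2 * c)‖ ≤ 1 / (2 * c) ↔ ‖u + I / (2 * c)‖ ^ 2 ≤ (1 / (2 * c)) ^ 2 := by
    rw [sq_le_sq₀ (norm_nonneg _) (by positivity)]
  have h2 : u + I / (2 * c) = ⟨u.re, u.im + 1 / (2 * c)⟩ := by
    have h3 : (I / (2 * c) : ℂ) = ((1 / (2 * c) : ℝ) : ℂ) * I := by push_cast; ring
    apply Complex.ext <;> simp [h3]
  rw [h1, ← Complex.normSq_eq_norm_sq, h2, Complex.normSq_mk, Complex.normSq_apply]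
  have h4 : u.re * u.re + (u.im + 1 / (2 * c)) * (u.im + 1 / (2 * c)) =
      (c * (u.re * u.re + u.im * u.im) + u.im) / c + (1 / (2 * c)) ^ 2 := by
    field_simp; ring
  rw [h4, add_le_iff_nonpos_left, div_le_iff₀ hc]
  constructor <;> intro h <;> linarith

/-- Every value `1 / (z - t)` lies on the boundary of the disc from `norm_add_I_div_le_iff` with `c
= Im z`, and an average of points of a disc stays in it. After inversion this says that `F` does not
lower imaginary parts. -/
theorem im_mul_normSq_cauchyTransform_le (μ : ProbabilityMeasure ℝ) {z : ℂ} (hz : 0 < z.im) :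
    z.im * Complex.normSq (cauchyTransform μ z) ≤ -(cauchyTransform μ z).im := by
  rw [← norm_add_I_div_le_iff hz]
  have h1 : ∀ t : ℝ, ‖1 / (z - (t : ℂ)) + I / (2 * z.im)‖ ≤ 1 / (2 * z.im) := by
    intro t
    rw [norm_add_I_div_le_iff hz, im_one_div_sub_ofReal, one_div, Complex.normSq_inv,
      normSq_sub_ofReal, neg_neg, div_eq_mul_inv]
  have h2 := norm_integral_le_of_norm_le_const (μ := (μ : Measure ℝ)) (ae_of_all _ h1)
  rw [integral_add (integrable_one_div_sub_ofReal μ hz) (integrable_const _)] at h2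
  simpa [cauchyTransform] using h2

theorem im_le_im_fTransform (μ : ProbabilityMeasure ℝ) {z : ℂ} (hz : 0 < z.im) :
    z.im ≤ (fTransform μ z).im := by
  have h := im_mul_normSq_cauchyTransform_le μ hz
  have hp := Complex.normSq_pos.2 (cauchyTransform_ne_zero μ hz)
  rw [fTransform, one_div, Complex.inv_im, le_div_iff₀ hp]
  exact h

theorem sub_kTransform (μ : ProbabilityMeasure ℝ) (z : ℂ) :
    z - kTransform μ z = fTransform μ z := by
  rw [kTransform]; ring

theorem im_le_im_sub_kTransform (μ : ProbabilityMeasure ℝ) {z : ℂ} (hz : 0 < z.im) :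
    z.im ≤ (z - kTransform μ z).im := by
  rw [sub_kTransform]; exact im_le_im_fTransform μ hz

theorem kTransform_im_nonpos (μ : ProbabilityMeasure ℝ) {z : ℂ} (hz : 0 < z.im) :
    (kTransform μ z).im ≤ 0 := by
  have := im_le_im_sub_kTransform μ hz
  simp at this
  exact this

theorem cauchyTransform_eq_of_kTransform_eq {μ ν : ProbabilityMeasure ℝ} {z : ℂ}
    (h : kTransform μ z = kTransform ν z) : cauchyTransform μ z = cauchyTransform ν z := by
  have h1 : fTransform μ z = fTransform ν z := by
    rw [← sub_kTransform, h, sub_kTransform]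
  simpa [fTransform] using h1

theorem isOpen_upperHalfPlane : IsOpen {z : ℂ | 0 < z.im} :=
  isOpen_lt continuous_const Complex.continuous_im

theorem isPreconnected_upperHalfPlane : IsPreconnected {z : ℂ | 0 < z.im} :=
  (convex_halfSpace_im_gt 0).isPreconnected

theorem cauchyTransform_eq_neg_resolventTransform (μ : ProbabilityMeasure ℝ) :
    cauchyTransform μ = fun z => -resolventTransform (μ : Measure ℝ) z := by
  ext z
  rw [cauchyTransform, resolventTransform_apply, ← integral_neg]
  congr 1
  ext t
  rw [resolvent, Ring.inverse_eq_inv', ← neg_sub, one_div, inv_neg]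
  rfl

theorem differentiableAt_cauchyTransform (μ : ProbabilityMeasure ℝ) {z : ℂ} (hz : 0 < z.im) :
    DifferentiableAt ℂ (cauchyTransform μ) z := by
  rw [cauchyTransform_eq_neg_resolventTransform]
  refine (hasDerivAt_resolventTransform z ?_).differentiableAt.neg
  rintro ⟨t, -, rfl⟩
  simp at hz

theorem differentiableAt_fTransform (μ : ProbabilityMeasure ℝ) {z : ℂ} (hz : 0 < z.im) :
    DifferentiableAt ℂ (fTransform μ) z :=
  (differentiableAt_const 1).div (differentiableAt_cauchyTransform μ hz)
    (cauchyTransform_ne_zero μ hz)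

theorem differentiableAt_kTransform (μ : ProbabilityMeasure ℝ) {z : ℂ} (hz : 0 < z.im) :
    DifferentiableAt ℂ (kTransform μ) z :=
  differentiableAt_id.sub (differentiableAt_fTransform μ hz)

/-- The function `t ↦ 1 / (z - t)` as a bounded continuous function. -/
def resolventBCF (z : ℂ) (hz : 0 < z.im) : BoundedContinuousFunction ℝ ℂ :=
  BoundedContinuousFunction.ofNormedAddCommGroup (fun t : ℝ => 1 / (z - (t : ℂ)))
    (continuous_one_div_sub_ofReal hz) (1 / z.im) (norm_one_div_sub_ofReal_le hz)

theorem continuous_cauchyTransform_measure {z : ℂ} (hz : 0 < z.im) :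
    Continuous fun μ : ProbabilityMeasure ℝ => cauchyTransform μ z := by
  rw [continuous_iff_continuousAt]
  intro μ
  exact (ProbabilityMeasure.tendsto_iff_forall_integral_rclike_tendsto ℂ).1 tendsto_id
    (resolventBCF z hz)

theorem continuous_kTransform_measure {z : ℂ} (hz : 0 < z.im) :
    Continuous fun μ : ProbabilityMeasure ℝ => kTransform μ z :=
  continuous_const.sub (continuous_const.div (continuous_cauchyTransform_measure hz)
    fun μ => cauchyTransform_ne_zero μ hz)

/-! ### The Cauchy transform determines the measure -/

open ProbabilityTheory in
theorem lintegral_cauchyPDF_sub (μ : ProbabilityMeasure ℝ) {ε : NNReal} (hε : ε ≠ 0) (x : ℝ) :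
    ∫⁻ t : ℝ, cauchyPDF 0 ε (x - t) ∂(μ : Measure ℝ) =
      ENNReal.ofReal (Real.pi⁻¹ * -(cauchyTransform μ (x + ε * I)).im) := by
  have hz : 0 < ((x : ℂ) + ε * I).im := by
    simpa using pos_iff_ne_zero.2 hε
  have hre : ((x : ℂ) + ε * I).re = x := by simp
  have him : ((x : ℂ) + ε * I).im = ε := by simp
  have hint := integrable_poisson μ hz
  have h := neg_im_cauchyTransform μ hz
  rw [hre, him] at h hint
  rw [h, ← integral_const_mul, ofReal_integral_eq_lintegral_ofReal (hint.const_mul _)]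
  · refine lintegral_congr fun t => ?_
    rw [cauchyPDF_def, cauchyPDFReal_def]
    congr 1
    simp only [sub_zero]
    ring
  · exact ae_of_all _ fun t => by positivity

-- Smoothing by a Cauchy law of scale `ε` turns `μ` into a density read off from `G_μ` on the line
-- `Im z = ε`; this is Stieltjes inversion without a limit.
open ProbabilityTheory in
theorem conv_cauchyMeasure (μ : ProbabilityMeasure ℝ) {ε : NNReal} (hε : ε ≠ 0) :
    (μ : Measure ℝ) ∗ cauchyMeasure 0 ε = volume.withDensity fun x : ℝ =>
      ENNReal.ofReal (Real.pi⁻¹ * -(cauchyTransform μ (x + ε * I)).im) := by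
  ext A hA
  rw [withDensity_apply _ hA, ← lintegral_indicator_one hA,
    Measure.lintegral_conv (measurable_one.indicator hA), ← lintegral_indicator hA]
  have hp : Measurable (cauchyPDF 0 ε) := measurable_cauchyPDF 0 ε
  have hA1 : Measurable (A.indicator (1 : ℝ → ENNReal)) := measurable_one.indicator hA
  have h1 : ∀ t : ℝ, ∫⁻ s, A.indicator (1 : ℝ → ENNReal) (t + s) ∂(cauchyMeasure 0 ε) =
      ∫⁻ x, cauchyPDF 0 ε (x - t) * A.indicator (1 : ℝ → ENNReal) x := by
    intro t
    have h2 := lintegral_withDensity_eq_lintegral_mul volume hp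
      (hA1.comp (measurable_const_add t))
    simp only [Function.comp_apply] at h2
    rw [cauchyMeasure_of_scale_ne_zero 0 hε, h2,
      ← lintegral_add_right_eq_self (μ := volume)
        (fun x => cauchyPDF 0 ε (x - t) * A.indicator (1 : ℝ → ENNReal) x) t]
    refine lintegral_congr fun s => ?_
    simp [add_comm]
  simp_rw [h1]
  rw [lintegral_lintegral_swap]
  · refine lintegral_congr fun x => ?_
    rw [lintegral_mul_const _ (by fun_prop), lintegral_cauchyPDF_sub μ hε]
    by_cases hx : x ∈ A <;> simp [hx]
  · fun_prop

-- Scaling replaces the explicit formula `exp (-ε|t|)`: with continuity at `0` it already shows that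
-- the characteristic function is nonzero at a given `t` for small `ε`.
open ProbabilityTheory in
theorem charFun_cauchyMeasure_scale {ε : NNReal} (hε : ε ≠ 0) (t : ℝ) :
    charFun (cauchyMeasure 0 ε) t = charFun (cauchyMeasure 0 1) (ε * t) := by
  have key : ∀ δ : NNReal, δ ≠ 0 → ∀ t : ℝ, charFun (cauchyMeasure 0 δ) t =
      ∫ x : ℝ, cauchyPDFReal 0 δ x • cexp (t * x * I) := by
    intro δ hδ t
    rw [charFun_apply_real, cauchyMeasure_of_scale_ne_zero 0 hδ,
      integral_withDensity_eq_integral_toReal_smul (by fun_prop)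
        (ae_of_all _ fun x => by simp [cauchyPDF])]
    refine integral_congr_ae (ae_of_all _ fun x => ?_)
    simp only [cauchyPDF, ENNReal.toReal_ofReal (cauchyPDF_pos 0 hδ x).le]
  have hε' : (0 : ℝ) < ε := by simpa using pos_iff_ne_zero.2 hε
  rw [key ε hε, key 1 one_ne_zero]
  have h := Measure.integral_comp_mul_left
    (fun x : ℝ => cauchyPDFReal 0 ε x • cexp (t * x * I)) (ε : ℝ)
  rw [abs_of_pos (inv_pos.2 hε')] at h
  have h2 : ∫ x : ℝ, cauchyPDFReal 0 ε x • cexp (t * x * I) =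
      (ε : ℝ) • ∫ x : ℝ, cauchyPDFReal 0 ε (ε * x) • cexp (t * (ε * x : ℝ) * I) := by
    rw [h, smul_smul, mul_inv_cancel₀ hε'.ne', one_smul]
  rw [h2, ← integral_smul]
  refine integral_congr_ae (ae_of_all _ fun x => ?_)
  simp only [smul_smul]
  congr 1
  · rw [cauchyPDFReal_def, cauchyPDFReal_def]
    simp only [sub_zero, NNReal.coe_one, one_pow]
    have : ((ε : ℝ) * x) ^ 2 + (ε : ℝ) ^ 2 = (ε : ℝ) ^ 2 * (x ^ 2 + 1) := by ring
    rw [this]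
    field_simp
  · congr 1
    push_cast
    ring

theorem eq_of_cauchyTransform_eq {μ ν : ProbabilityMeasure ℝ}
    (h : ∀ z : ℂ, 0 < z.im → cauchyTransform μ z = cauchyTransform ν z) : μ = ν := by
  apply Subtype.ext
  have hμ : IsFiniteMeasure (μ : Measure ℝ) := inferInstance
  have hν : IsFiniteMeasure (ν : Measure ℝ) := inferInstance
  apply @Measure.ext_of_charFun _ _ _ _ _ _ _ _ _ hμ hν
  ext t
  -- The scale may depend on `t`: it is chosen so that the Cauchy factor does not vanish at `t` and
  -- can be cancelled.
  have hκ : Tendsto (fun n : ℕ => charFun (ProbabilityTheory.cauchyMeasure 0 1)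
      (1 / (n + 1 : ℝ) * t)) atTop (𝓝 1) := by
    have h1 : Tendsto (fun n : ℕ => (1 / (n + 1 : ℝ) * t)) atTop (𝓝 0) := by
      simpa using (tendsto_one_div_add_atTop_nhds_zero_nat (𝕜 := ℝ)).mul_const t
    have h2 := (continuous_charFun (μ := ProbabilityTheory.cauchyMeasure 0 1)).continuousAt
      (x := 0)
    have h3 := h2.tendsto.comp h1
    simpa [charFun_zero, Function.comp_def] using h3
  obtain ⟨n, hn⟩ := (hκ.eventually_ne one_ne_zero).exists
  have hε : (1 / (n + 1) : NNReal) ≠ 0 := by positivity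
  have hn' : charFun (ProbabilityTheory.cauchyMeasure 0 (1 / (n + 1) : NNReal)) t ≠ 0 := by
    rw [charFun_cauchyMeasure_scale hε]
    simpa using hn
  have heq : (μ : Measure ℝ) ∗ ProbabilityTheory.cauchyMeasure 0 (1 / (n + 1) : NNReal) =
      (ν : Measure ℝ) ∗ ProbabilityTheory.cauchyMeasure 0 (1 / (n + 1) : NNReal) := by
    rw [conv_cauchyMeasure μ hε, conv_cauchyMeasure ν hε]
    congr 1
    ext x
    rw [h]
    have hpos : (0 : ℝ) < (1 / (n + 1) : NNReal) := NNReal.coe_pos.2 (pos_iff_ne_zero.2 hε)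
    rw [add_im, ofReal_im, zero_add, im_ofReal_mul, I_im, mul_one]
    exact hpos
  have h4 := congrArg (fun m => charFun m t) heq
  simp only [charFun_conv] at h4
  exact mul_right_cancel₀ hn' h4

theorem eq_of_cauchyTransform_eventuallyEq {μ ν : ProbabilityMeasure ℝ} {z₀ : ℂ}
    (hz₀ : 0 < z₀.im) (h : cauchyTransform μ =ᶠ[𝓝 z₀] cauchyTransform ν) : μ = ν := by
  refine eq_of_cauchyTransform_eq fun z hz => ?_
  have hA : ∀ m : ProbabilityMeasure ℝ, AnalyticOnNhd ℂ (cauchyTransform m) {z | 0 < z.im} :=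
    fun m => DifferentiableOn.analyticOnNhd
      (fun w hw => (differentiableAt_cauchyTransform m hw).differentiableWithinAt)
      isOpen_upperHalfPlane
  exact (hA μ).eqOn_of_preconnected_of_eventuallyEq (hA ν) isPreconnected_upperHalfPlane hz₀ h hz

theorem eq_of_kTransform_eq {μ ν : ProbabilityMeasure ℝ}
    (h : ∀ z : ℂ, 0 < z.im → kTransform μ z = kTransform ν z) : μ = ν :=
  eq_of_cauchyTransform_eq fun z hz => cauchyTransform_eq_of_kTransform_eq (h z hz)

/-! ### Tightness and weak convergence -/

/-- The quantity `1 + y Im G(iy)` is the integral of `t² / (t² + y²)`, which is at least `1/2` once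
`|t| ≥ y`. -/
theorem measureReal_abs_ge_le (μ : ProbabilityMeasure ℝ) {y : ℝ} (hy : 0 < y) :
    (μ : Measure ℝ).real (Set.Icc (-y) y)ᶜ ≤ 2 * (1 + y * (cauchyTransform μ (y * I)).im) := by
  have hz : 0 < ((y : ℂ) * I).im := by simpa using hy
  have h := neg_im_cauchyTransform μ hz
  have hi := integrable_poisson μ hz
  simp only [mul_re, ofReal_re, I_re, mul_zero, ofReal_im, I_im, mul_one, sub_self, mul_im,
    add_zero, zero_sub, neg_sq] at h hi
  have h1 : 1 + y * (cauchyTransform μ (y * I)).im =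
      ∫ t : ℝ, (1 - y * (y / (t ^ 2 + y ^ 2))) ∂(μ : Measure ℝ) := by
    rw [integral_sub (integrable_const _) (hi.const_mul y), integral_const_mul, ← h]
    simp
  have h2 : (μ : Measure ℝ).real (Set.Icc (-y) y)ᶜ =
      ∫ t : ℝ, (Set.Icc (-y) y)ᶜ.indicator 1 t ∂(μ : Measure ℝ) := by
    rw [integral_indicator_one measurableSet_Icc.compl]
  rw [h1, h2, ← integral_const_mul]
  refine integral_mono ((integrable_indicator_iff measurableSet_Icc.compl).2
    (integrable_const _).integrableOn) (((integrable_const _).sub (hi.const_mul y)).const_mul 2)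
    fun t => ?_
  have hd : 0 < t ^ 2 + y ^ 2 := by positivity
  have h3 : 1 - y * (y / (t ^ 2 + y ^ 2)) = t ^ 2 / (t ^ 2 + y ^ 2) := by
    field_simp; ring
  simp only [h3]
  by_cases ht : t ∈ Set.Icc (-y) y
  · rw [Set.indicator_of_notMem (by simpa using ht)]
    positivity
  · rw [Set.indicator_of_mem (by simpa using ht), Pi.one_apply, ← mul_div_assoc, le_div_iff₀ hd]
    have : y ^ 2 ≤ t ^ 2 := by
      rw [← sq_abs t]
      refine pow_le_pow_left₀ hy.le ?_ 2
      by_contra hlt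
      exact ht (abs_le.1 (not_le.1 hlt).le)
    linarith

theorem isTightMeasureSet_of_cauchyTransform {ι : Type*} {μ : ι → ProbabilityMeasure ℝ}
    (h : ∀ δ : ℝ, 0 < δ → ∃ y : ℝ, 0 < y ∧ ∀ i, 1 + y * (cauchyTransform (μ i) (y * I)).im ≤ δ) :
    IsTightMeasureSet {((m : ProbabilityMeasure ℝ) : Measure ℝ) | m ∈ Set.range μ} := by
  rw [isTightMeasureSet_iff_exists_isCompact_measure_compl_le]
  intro ε hε
  by_cases hε' : ε = ⊤
  · exact ⟨∅, isCompact_empty, fun _ _ => by simp [hε']⟩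
  obtain ⟨y, hy, hy'⟩ := h (ε.toReal / 2) (by have := ENNReal.toReal_pos hε.ne' hε'; positivity)
  refine ⟨Set.Icc (-y) y, isCompact_Icc, ?_⟩
  rintro _ ⟨_, ⟨i, rfl⟩, rfl⟩
  rw [← ENNReal.ofReal_toReal hε', ← ofReal_measureReal]
  refine ENNReal.ofReal_le_ofReal ((measureReal_abs_ge_le (μ i) hy).trans ?_)
  linarith [hy' i]

/-- Convergence of the Cauchy transforms near a point, together with tightness, implies weak
convergence. -/
theorem exists_tendsto_of_tendsto_cauchyTransform {ι : Type*} {l : Filter ι} [l.NeBot]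
    {μ : ι → ProbabilityMeasure ℝ}
    (ht : IsTightMeasureSet {((m : ProbabilityMeasure ℝ) : Measure ℝ) | m ∈ Set.range μ})
    {g : ℂ → ℂ} {z₀ : ℂ} (hz₀ : 0 < z₀.im)
    (hg : ∀ᶠ z in 𝓝 z₀, Tendsto (fun i => cauchyTransform (μ i) z) l (𝓝 (g z))) :
    ∃ ν, Tendsto μ l (𝓝 ν) := by
  have hc := isCompact_closure_of_isTightMeasureSet ht
  have hmem : ∀ i, μ i ∈ closure (Set.range μ) := fun i => subset_closure ⟨i, rfl⟩
  -- All cluster points share the transform `g` near `z₀`, hence coincide; in a compact set a unique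
  -- cluster point is a limit.
  have key : ∀ ν, MapClusterPt ν l μ → cauchyTransform ν =ᶠ[𝓝 z₀] g := by
    intro ν hν
    filter_upwards [hg, isOpen_upperHalfPlane.mem_nhds hz₀] with z hz hzim
    have h1 : MapClusterPt (cauchyTransform ν z) l (fun i => cauchyTransform (μ i) z) :=
      hν.continuousAt_comp (continuous_cauchyTransform_measure hzim).continuousAt
    have h2 : ClusterPt (cauchyTransform ν z) (𝓝 (g z)) := ClusterPt.mono h1 hz
    exact eq_of_nhds_neBot h2
  obtain ⟨ν, -, hν⟩ := hc.exists_mapClusterPt (f := l) (u := μ)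
    (tendsto_principal.2 (Eventually.of_forall hmem))
  refine ⟨ν, hc.tendsto_nhds_of_unique_mapClusterPt (Eventually.of_forall hmem) fun ν' _ hν' => ?_⟩
  exact eq_of_cauchyTransform_eventuallyEq hz₀ ((key ν' hν').trans (key ν hν).symm)

/-! ### The Poisson formula in the upper half-plane -/

/-- Cauchy's theorem on the rectangle `[-R, R] × [0, R]`: the three sides off the real axis have
total length `4R`, and there `h` is at most `|C| / R²`. -/
theorem integral_eq_zero_of_norm_le_div_sq {h : ℂ → ℂ} {C R₀ : ℝ}
    (hd : DifferentiableOn ℂ h {z | 0 ≤ z.im})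
    (hb : ∀ z : ℂ, 0 ≤ z.im → R₀ ≤ ‖z‖ → ‖h z‖ ≤ C / ‖z‖ ^ 2)
    (hi : Integrable fun x : ℝ => h x) : ∫ x : ℝ, h x = 0 := by
  have h1 : Tendsto (fun R : ℝ => ∫ x in (-R)..R, h x) atTop (𝓝 (∫ x : ℝ, h x)) :=
    intervalIntegral_tendsto_integral hi tendsto_neg_atTop_atBot tendsto_id
  refine tendsto_nhds_unique h1 ?_
  have hlim : Tendsto (fun R : ℝ => 4 * |C| * R⁻¹) atTop (𝓝 0) := by
    simpa using tendsto_inv_atTop_zero.const_mul (4 * |C|)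
  refine squeeze_zero_norm' ?_ hlim
  filter_upwards [eventually_ge_atTop R₀, eventually_gt_atTop 0] with R hR hR0
  have hrect := integral_boundary_rect_eq_zero_of_differentiableOn h (-R : ℂ) (R + R * I : ℂ)
    (hd.mono ?_)
  swap
  · intro z hz
    have := hz.2
    simp only [Set.mem_preimage, neg_im, ofReal_im, neg_zero, add_im, mul_im, ofReal_re, I_im,
      mul_one, I_re, mul_zero, add_zero, zero_add] at this
    rw [Set.uIcc_of_le hR0.le] at this
    exact this.1
  simp only [neg_im, ofReal_im, neg_zero, add_im, mul_im, ofReal_re, I_im, mul_one, I_re, mul_zero,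
    add_zero, zero_add, neg_re, add_re, mul_re, sub_self, ofReal_zero, zero_mul, ofReal_neg] at hrect
  have hbound : ∀ z : ℂ, 0 ≤ z.im → R ≤ ‖z‖ → ‖h z‖ ≤ |C| / R ^ 2 := fun z hz hRz =>
    (hb z hz (hR.trans hRz)).trans (div_le_div₀ (abs_nonneg C) (le_abs_self C) (by positivity)
      (pow_le_pow_left₀ hR0.le hRz 2))
  have hA : ‖∫ x in (-R)..R, h (x + R * I)‖ ≤ |C| / R ^ 2 * |R - -R| := by
    refine intervalIntegral.norm_integral_le_of_norm_le_const fun x _ => hbound _ ?_ ?_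
    · simpa using hR0.le
    · simpa [abs_of_pos hR0] using abs_im_le_norm ((x : ℂ) + R * I)
  have hB : ‖∫ y in (0 : ℝ)..R, h (R + y * I)‖ ≤ |C| / R ^ 2 * |R - 0| := by
    refine intervalIntegral.norm_integral_le_of_norm_le_const fun y hy => hbound _ ?_ ?_
    · rw [Set.uIoc_of_le hR0.le] at hy
      simpa using hy.1.le
    · simpa [abs_of_pos hR0] using abs_re_le_norm ((R : ℂ) + y * I)
  have hC : ‖∫ y in (0 : ℝ)..R, h (-R + y * I)‖ ≤ |C| / R ^ 2 * |R - 0| := by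
    refine intervalIntegral.norm_integral_le_of_norm_le_const fun y hy => hbound _ ?_ ?_
    · rw [Set.uIoc_of_le hR0.le] at hy
      simpa using hy.1.le
    · simpa [abs_of_pos hR0] using abs_re_le_norm (-(R : ℂ) + y * I)
  have heq : ∫ x in (-R)..R, h x = (∫ x in (-R)..R, h (x + R * I)) -
      I • (∫ y in (0 : ℝ)..R, h (R + y * I)) + I • ∫ y in (0 : ℝ)..R, h (-R + y * I) := by
    rw [← sub_eq_zero, ← hrect]; ring
  rw [heq]
  refine (norm_add_le _ _).trans ((add_le_add_left (norm_sub_le _ _) _).trans ?_)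
  rw [norm_smul, norm_smul, norm_I, one_mul, one_mul]
  refine (add_le_add (add_le_add hA hB) hC).trans (le_of_eq ?_)
  rw [sub_neg_eq_add, sub_zero, abs_of_pos hR0, abs_of_pos (by linarith : 0 < R + R)]
  field_simp
  ring

theorem poissonKernel_eq_mul_cauchyPDFReal (x : ℝ) {y : ℝ} (hy : 0 < y) (t : ℝ) :
    y / ((x - t) ^ 2 + y ^ 2) =
      Real.pi * ProbabilityTheory.cauchyPDFReal x (Real.toNNReal y) t := by
  rw [ProbabilityTheory.cauchyPDFReal_def, Real.coe_toNNReal y hy.le,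
    show (x - t) ^ 2 = (t - x) ^ 2 by ring]
  field_simp

theorem integrable_poissonKernel (x : ℝ) {y : ℝ} (hy : 0 < y) :
    Integrable fun t : ℝ => y / ((x - t) ^ 2 + y ^ 2) := by
  simp_rw [poissonKernel_eq_mul_cauchyPDFReal x hy]
  exact (ProbabilityTheory.integrable_cauchyPDFReal x).const_mul Real.pi

theorem integral_poissonKernel (x : ℝ) {y : ℝ} (hy : 0 < y) :
    ∫ t : ℝ, y / ((x - t) ^ 2 + y ^ 2) = Real.pi := by
  simp_rw [poissonKernel_eq_mul_cauchyPDFReal x hy]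
  rw [integral_const_mul, ProbabilityTheory.integral_cauchyPDFReal_eq_one x
    (Real.toNNReal_pos.2 hy).ne', mul_one]

theorem mul_conj_sub_ofReal (z : ℂ) (t : ℝ) :
    ((t : ℂ) - z) * (t - (starRingEnd ℂ) z) = (((z.re - t) ^ 2 + z.im ^ 2 : ℝ) : ℂ) := by
  rw [← normSq_sub_ofReal, ← Complex.mul_conj]
  simp; ring

theorem integrable_mul_poissonKernel {f : ℝ → ℂ} (hf : Continuous f) {M : ℝ}
    (hM : ∀ t, ‖f t‖ ≤ M) (x : ℝ) {y : ℝ} (hy : 0 < y) :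
    Integrable fun t : ℝ => f t * ((y / ((x - t) ^ 2 + y ^ 2) : ℝ) : ℂ) :=
  (integrable_poissonKernel x hy).ofReal.bdd_mul hf.aestronglyMeasurable (ae_of_all _ hM)

/-- The Poisson formula for bounded holomorphic functions. -/
theorem integral_mul_poissonKernel {g : ℂ → ℂ} {U : Set ℂ} (hU : IsOpen U)
    (hsub : {z : ℂ | 0 ≤ z.im} ⊆ U) (hd : DifferentiableOn ℂ g U) {M : ℝ}
    (hM : ∀ z : ℂ, 0 ≤ z.im → ‖g z‖ ≤ M) {z : ℂ} (hz : 0 < z.im) :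
    ∫ t : ℝ, g t * ((z.im / ((z.re - t) ^ 2 + z.im ^ 2) : ℝ) : ℂ) = Real.pi * g z := by
  have hM0 : 0 ≤ M := (norm_nonneg _).trans (hM z hz.le)
  have hcont : Continuous fun t : ℝ => g t :=
    hd.continuousOn.comp_continuous continuous_ofReal fun t => hsub (by simp)
  have hMt : ∀ t : ℝ, ‖g t‖ ≤ M := fun t => hM t (by simp)
  have hig := integrable_mul_poissonKernel hcont hMt z.re hz
  have hic : Integrable fun t : ℝ =>
      g z * ((z.im / ((z.re - t) ^ 2 + z.im ^ 2) : ℝ) : ℂ) :=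
    (integrable_poissonKernel z.re hz).ofReal.const_mul (g z)
  have hπ : ∫ t : ℝ, ((z.im / ((z.re - t) ^ 2 + z.im ^ 2) : ℝ) : ℂ) = Real.pi := by
    rw [← integral_poissonKernel z.re hz]
    exact integral_ofReal
  have hne : ∀ w : ℂ, 0 ≤ w.im → w - (starRingEnd ℂ) z ≠ 0 := by
    intro w hw h0
    have := congrArg Complex.im h0
    simp at this
    linarith
  -- On the real line `(z - z̄) / ((t - z)(t - z̄))` is `2i` times the Poisson kernel, so `∫ h = 0`
  -- is the claimed formula. Subtracting `g z` makes the singularity at `z` removable, which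
  -- `dslope` encodes, and `h` decays quadratically.
  set h : ℂ → ℂ := fun w => dslope g z w * ((z - (starRingEnd ℂ) z) / (w - (starRingEnd ℂ) z))
    with hdef
  have hreal : ∀ t : ℝ, h t = (2 * I) * (g t * ((z.im / ((z.re - t) ^ 2 + z.im ^ 2) : ℝ) : ℂ) -
      g z * ((z.im / ((z.re - t) ^ 2 + z.im ^ 2) : ℝ) : ℂ)) := by
    intro t
    have hne1 : (t : ℂ) - z ≠ 0 := by
      rw [← neg_sub, neg_ne_zero]; exact sub_ofReal_ne_zero hz t
    have hne2 := hne t (by simp)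
    have hd2 : (2 * I) * ((z.im / ((z.re - t) ^ 2 + z.im ^ 2) : ℝ) : ℂ) =
        (z - (starRingEnd ℂ) z) / (((t : ℂ) - z) * (t - (starRingEnd ℂ) z)) := by
      rw [mul_conj_sub_ofReal, sub_conj]
      push_cast
      ring
    rw [← sub_mul, mul_left_comm, hd2]
    simp only [hdef]
    rw [dslope_of_ne _ (sub_ne_zero.1 hne1), slope_def_field]
    field_simp
  have hint : Integrable fun x : ℝ => h x := by
    simp_rw [hreal]
    exact (hig.sub hic).const_mul _
  have hzero : ∫ x : ℝ, h x = 0 := by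
    refine integral_eq_zero_of_norm_le_div_sq (C := (M + M) * 2 * (2 * ‖z - (starRingEnd ℂ) z‖))
      (R₀ := 2 * ‖z‖ + 1) ?_ ?_ hint
    · refine DifferentiableOn.mul ?_ ?_
      · exact ((differentiableOn_dslope (hU.mem_nhds (hsub hz.le))).2 hd).mono hsub
      · exact (differentiableOn_const _).div (differentiableOn_id.sub (differentiableOn_const _))
          fun w hw => hne w hw
    · intro w hw hRw
      have hz0 := norm_nonneg z
      have hw0 : 0 < ‖w‖ := by linarith
      have h1 : ‖w‖ / 2 ≤ ‖w - z‖ := by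
        have := norm_sub_norm_le w z
        linarith
      have h2 : ‖w‖ / 2 ≤ ‖w - (starRingEnd ℂ) z‖ := by
        have := norm_sub_norm_le w ((starRingEnd ℂ) z)
        rw [Complex.norm_conj] at this
        linarith
      have hwz : w ≠ z := by
        rintro rfl; simp at h1; linarith
      simp only [hdef]
      rw [dslope_of_ne _ hwz, slope_def_field, norm_mul, norm_div, norm_div]
      have h3 : ‖g w - g z‖ ≤ M + M := (norm_sub_le _ _).trans (add_le_add (hM w hw) (hM z hz.le))
      calc ‖g w - g z‖ / ‖w - z‖ * (‖z - (starRingEnd ℂ) z‖ / ‖w - (starRingEnd ℂ) z‖)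
          ≤ (M + M) / (‖w‖ / 2) * (‖z - (starRingEnd ℂ) z‖ / (‖w‖ / 2)) := by gcongr
        _ = _ := by field_simp
  simp_rw [hreal] at hzero
  rw [integral_const_mul, integral_sub hig hic, integral_const_mul, hπ,
    mul_eq_zero, sub_eq_zero] at hzero
  rcases hzero with h0 | h0
  · simp at h0
  · rw [h0, mul_comm]

/-! ### Recognizing Cauchy transforms -/

/-- Since `g` extends across the real line, the measure can be written down: its density is the
boundary value of `-Im g / π`, and the Poisson formula recovers `Im g`. -/
theorem exists_im_cauchyTransform_eq {g : ℂ → ℂ} {U : Set ℂ} (hU : IsOpen U)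
    (hsub : {z : ℂ | 0 ≤ z.im} ⊆ U) (hd : DifferentiableOn ℂ g U) {M : ℝ}
    (hM : ∀ z : ℂ, 0 ≤ z.im → ‖g z‖ ≤ M) (him : ∀ z : ℂ, 0 ≤ z.im → (g z).im ≤ 0)
    (hlim : Tendsto (fun y : ℝ => y * (g (y * I)).im) atTop (𝓝 (-1))) :
    ∃ μ : ProbabilityMeasure ℝ, ∀ z : ℂ, 0 < z.im → (cauchyTransform μ z).im = (g z).im := by
  have hcont : Continuous fun t : ℝ => g t :=
    hd.continuousOn.comp_continuous continuous_ofReal fun t => hsub (by simp)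
  set ρ : ℝ → ℝ := fun t => Real.pi⁻¹ * -(g t).im with hρ
  have hρc : Continuous ρ := continuous_const.mul (continuous_im.comp hcont).neg
  have hρ0 : ∀ t, 0 ≤ ρ t := fun t =>
    mul_nonneg (inv_nonneg.2 Real.pi_pos.le) (neg_nonneg.2 (him t (by simp)))
  have hint : ∀ z : ℂ, 0 < z.im →
      Integrable fun t : ℝ => ρ t * (z.im / ((z.re - t) ^ 2 + z.im ^ 2)) := by
    intro z hz
    have h := imCLM.integrable_comp
      (integrable_mul_poissonKernel hcont (fun t => hM t (by simp)) z.re hz)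
    refine (h.const_mul (-Real.pi⁻¹)).congr (ae_of_all _ fun t => ?_)
    simp only [imCLM_apply, im_mul_ofReal, hρ]
    ring
  have hP : ∀ z : ℂ, 0 < z.im →
      ∫ t : ℝ, ρ t * (z.im / ((z.re - t) ^ 2 + z.im ^ 2)) = -(g z).im := by
    intro z hz
    have h := imCLM.integral_comp_comm
      (integrable_mul_poissonKernel hcont (fun t => hM t (by simp)) z.re hz)
    rw [integral_mul_poissonKernel hU hsub hd hM hz] at h
    simp only [imCLM_apply, im_mul_ofReal, im_ofReal_mul] at h
    have h2 : ∫ t : ℝ, ρ t * (z.im / ((z.re - t) ^ 2 + z.im ^ 2)) =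
        ∫ t : ℝ, (-Real.pi⁻¹) * ((g t).im * (z.im / ((z.re - t) ^ 2 + z.im ^ 2))) := by
      refine integral_congr_ae (ae_of_all _ fun t => ?_)
      simp only [hρ]
      ring
    rw [h2, integral_const_mul, h]
    have := Real.pi_pos
    field_simp
  -- Integrability of `ρ` is not known beforehand, so the mass is computed by monotone convergence:
  -- the weights `y² / (t² + y²)` increase to `1` along `y = n + 1`, and the weighted integrals
  -- equal `-y Im g(iy)`.
  have hmass : ∫⁻ t : ℝ, ENNReal.ofReal (ρ t) = 1 := by
    have hmono : Tendsto (fun n : ℕ => ∫⁻ t : ℝ, ENNReal.ofReal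
        (ρ t * (((n : ℝ) + 1) ^ 2 / (t ^ 2 + ((n : ℝ) + 1) ^ 2)))) atTop
        (𝓝 (∫⁻ t : ℝ, ENNReal.ofReal (ρ t))) := by
      refine lintegral_tendsto_of_tendsto_of_monotone (fun n => ?_) (ae_of_all _ fun t => ?_)
        (ae_of_all _ fun t => ?_)
      · refine (ENNReal.measurable_ofReal.comp (hρc.measurable.mul ?_)).aemeasurable
        fun_prop
      · intro m n hmn
        refine ENNReal.ofReal_le_ofReal (mul_le_mul_of_nonneg_left ?_ (hρ0 t))
        have hmn' : ((m : ℝ) + 1) ^ 2 ≤ ((n : ℝ) + 1) ^ 2 := by gcongr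
        have hm : (0 : ℝ) < ((m : ℝ) + 1) ^ 2 := by positivity
        have ht := sq_nonneg t
        rw [div_le_div_iff₀ (by positivity) (by positivity)]
        nlinarith
      · refine (ENNReal.continuous_ofReal.tendsto _).comp ?_
        have h1 : Tendsto (fun n : ℕ => ((n : ℝ) + 1) ^ 2) atTop atTop :=
          (tendsto_pow_atTop two_ne_zero).comp
            (tendsto_atTop_add_const_right _ _ tendsto_natCast_atTop_atTop)
        have h2 : Tendsto (fun n : ℕ => t ^ 2 * (((n : ℝ) + 1) ^ 2)⁻¹ + 1) atTop (𝓝 1) := by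
          simpa using (h1.inv_tendsto_atTop.const_mul (t ^ 2)).add_const 1
        have h3 : Tendsto (fun n : ℕ => ρ t * (t ^ 2 * (((n : ℝ) + 1) ^ 2)⁻¹ + 1)⁻¹) atTop
            (𝓝 (ρ t)) := by
          simpa using (h2.inv₀ one_ne_zero).const_mul (ρ t)
        refine h3.congr fun n => ?_
        congr 1
        have : (0 : ℝ) < ((n : ℝ) + 1) ^ 2 := by positivity
        field_simp
    have hval : ∀ n : ℕ, ∫⁻ t : ℝ, ENNReal.ofReal
        (ρ t * (((n : ℝ) + 1) ^ 2 / (t ^ 2 + ((n : ℝ) + 1) ^ 2))) =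
        ENNReal.ofReal (-(((n : ℝ) + 1) * (g (((n : ℝ) + 1 : ℝ) * I)).im)) := by
      intro n
      have hz : 0 < ((((n : ℝ) + 1 : ℝ) : ℂ) * I).im := by
        rw [im_ofReal_mul, I_im, mul_one]; positivity
      have hp := hP _ hz
      have hi := hint _ hz
      have hre : ((((n : ℝ) + 1 : ℝ) : ℂ) * I).re = 0 := by simp
      have him' : ((((n : ℝ) + 1 : ℝ) : ℂ) * I).im = (n : ℝ) + 1 := by simp
      rw [hre, him'] at hp hi
      rw [← mul_neg, ← hp, ← integral_const_mul,
        ofReal_integral_eq_lintegral_ofReal (hi.const_mul _)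
          (ae_of_all _ fun t => by have := hρ0 t; positivity)]
      refine lintegral_congr fun t => ?_
      congr 1
      simp only [zero_sub, neg_sq]
      ring
    simp_rw [hval] at hmono
    refine tendsto_nhds_unique hmono ?_
    have h1 := hlim.neg.comp
      (tendsto_atTop_add_const_right atTop (1 : ℝ) tendsto_natCast_atTop_atTop)
    have h2 := (ENNReal.continuous_ofReal.tendsto _).comp h1
    simpa [Function.comp_def] using h2
  have hprob : IsProbabilityMeasure (volume.withDensity fun t => ENNReal.ofReal (ρ t)) :=
    ⟨by rw [withDensity_apply _ MeasurableSet.univ, Measure.restrict_univ, hmass]⟩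
  obtain ⟨μ, hμ⟩ : ∃ μ : ProbabilityMeasure ℝ,
      (μ : Measure ℝ) = volume.withDensity fun t => ENNReal.ofReal (ρ t) := ⟨⟨_, hprob⟩, rfl⟩
  refine ⟨μ, fun z hz => ?_⟩
  rw [← neg_inj, neg_im_cauchyTransform _ hz, ← hP z hz, hμ,
    integral_withDensity_eq_integral_toReal_smul
      hρc.measurable.ennreal_ofReal (ae_of_all _ fun t => ENNReal.ofReal_lt_top)]
  refine integral_congr_ae (ae_of_all _ fun t => ?_)
  simp only [ENNReal.toReal_ofReal (hρ0 t), smul_eq_mul]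

theorem exists_cauchyTransform_eq {G : ℂ → ℂ} (hd : DifferentiableOn ℂ G {z | 0 < z.im})
    (hb : ∀ z : ℂ, 0 < z.im → ‖G z‖ ≤ 1 / z.im) (him : ∀ z : ℂ, 0 < z.im → (G z).im ≤ 0)
    (hlim : Tendsto (fun y : ℝ => y * (G (y * I)).im) atTop (𝓝 (-1))) :
    ∃ μ : ProbabilityMeasure ℝ, ∀ z : ℂ, 0 < z.im → cauchyTransform μ z = G z := by
  -- `G` need not extend to the real line, but `G(z + iε)` does, and it is bounded by `1/ε`. The
  -- measures so obtained are tight, and a cluster point as `ε → 0` is the one sought.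
  have hshift : ∀ ε : ℝ, 0 < ε → ∃ μ : ProbabilityMeasure ℝ, ∀ z : ℂ, 0 < z.im →
      (cauchyTransform μ z).im = (G (z + ε * I)).im := by
    intro ε hε
    have hadd : ∀ z : ℂ, (z + ε * I).im = z.im + ε := fun z => by simp
    refine exists_im_cauchyTransform_eq (g := fun z => G (z + ε * I)) (U := {z | -ε < z.im})
      (M := 1 / ε) (isOpen_lt continuous_const continuous_im) (fun z hz => ?_) ?_ (fun z hz => ?_)
      (fun z hz => him _ ?_) ?_
    · exact lt_of_lt_of_le (neg_lt_zero.2 hε) hz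
    · refine hd.comp (differentiableOn_id.add_const _) fun z hz => ?_
      simp only [Set.mem_ofPred_eq, hadd] at hz ⊢
      linarith
    · refine (hb _ (by rw [hadd]; linarith)).trans (one_div_le_one_div_of_le hε ?_)
      rw [hadd]; linarith
    · rw [hadd]; linarith
    · have h1 : Tendsto (fun y : ℝ => y + ε) atTop atTop :=
        tendsto_atTop_add_const_right _ _ tendsto_id
      have h2 := hlim.comp h1
      have h3 : Tendsto (fun y : ℝ => 1 - ε * (y + ε)⁻¹) atTop (𝓝 1) := by
        simpa using ((tendsto_inv_atTop_zero.comp h1).const_mul ε).const_sub 1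
      have h4 := h3.mul h2
      rw [one_mul] at h4
      refine h4.congr' ?_
      filter_upwards [eventually_gt_atTop 0] with y hy
      have : y + ε ≠ 0 := by positivity
      simp only [Function.comp_apply]
      have h5 : ((y + ε : ℝ) : ℂ) * I = y * I + ε * I := by push_cast; ring
      rw [h5]
      field_simp
      ring
  choose! m hm using hshift
  set μ : ℕ → ProbabilityMeasure ℝ := fun n => m (1 / ((n : ℝ) + 1)) with hμ
  have hεpos : ∀ n : ℕ, 0 < 1 / ((n : ℝ) + 1) := fun n => by positivity
  have hμim : ∀ n : ℕ, ∀ z : ℂ, 0 < z.im →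
      (cauchyTransform (μ n) z).im = (G (z + (1 / ((n : ℝ) + 1) : ℝ) * I)).im :=
    fun n z hz => hm _ (hεpos n) z hz
  have htight : IsTightMeasureSet
      {((ν : ProbabilityMeasure ℝ) : Measure ℝ) | ν ∈ Set.range μ} := by
    refine isTightMeasureSet_of_cauchyTransform fun δ hδ => ?_
    have h1 : ∀ᶠ y : ℝ in atTop, y * (G (y * I)).im < -1 + δ / 2 :=
      hlim.eventually_lt_const (by linarith)
    obtain ⟨Y, hY⟩ := eventually_atTop.1 h1
    -- With `ε ≤ 1`, `1 + y Im G(i(y+ε))` is `1 + (y+ε) Im G(i(y+ε))`, below `δ/2` as `y ≥ Y`, plus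
    -- `-ε Im G(i(y+ε))`, at most `1/y ≤ δ/2`.
    set y : ℝ := max (max Y 1) (2 / δ) with hy
    have hyY : Y ≤ y := (le_max_left _ _).trans (le_max_left _ _)
    have hy1 : 1 ≤ y := (le_max_right _ _).trans (le_max_left _ _)
    have hyδ : 1 / y ≤ δ / 2 := by
      rw [div_le_iff₀ (by linarith)]
      have := (div_le_iff₀ hδ).1 (le_max_right (max Y 1) (2 / δ))
      rw [← hy] at this
      linarith
    refine ⟨y, by linarith, fun n => ?_⟩
    have hyim : ((y : ℂ) * I).im = y := by simp
    rw [hμim n _ (by rw [hyim]; linarith)]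
    set ε := 1 / ((n : ℝ) + 1) with hε
    have hε1 : ε ≤ 1 := by
      rw [hε, div_le_one (by positivity)]
      have := n.cast_nonneg (α := ℝ)
      linarith
    have hε0 : 0 < ε := hεpos n
    have h5 : (y : ℂ) * I + (ε : ℝ) * I = ((y + ε : ℝ) : ℂ) * I := by push_cast; ring
    rw [h5]
    have h6 := hY (y + ε) (by linarith)
    have him' : (((y + ε : ℝ) : ℂ) * I).im = y + ε := by simp
    have h7 := hb (((y + ε : ℝ) : ℂ) * I) (by rw [him']; linarith)
    rw [him'] at h7
    have h8 : -(G (((y + ε : ℝ) : ℂ) * I)).im ≤ 1 / y :=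
      ((neg_le_abs _).trans (abs_im_le_norm _)).trans
        (h7.trans (one_div_le_one_div_of_le (by linarith) (by linarith)))
    have h9 := him (((y + ε : ℝ) : ℂ) * I) (by rw [him']; linarith)
    nlinarith
  have hc := isCompact_closure_of_isTightMeasureSet htight
  obtain ⟨ν, -, hν⟩ := hc.exists_mapClusterPt (f := atTop) (u := μ)
    (tendsto_principal.2 (Eventually.of_forall fun i => subset_closure ⟨i, rfl⟩))
  have hνim : ∀ z : ℂ, 0 < z.im → (cauchyTransform ν z).im = (G z).im := by
    intro z hz
    have h1 : MapClusterPt (cauchyTransform ν z).im atTop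
        (fun n => (cauchyTransform (μ n) z).im) :=
      hν.continuousAt_comp (f := fun m => (cauchyTransform m z).im)
        (continuous_im.comp (continuous_cauchyTransform_measure hz)).continuousAt
    have h2 : Tendsto (fun n => (cauchyTransform (μ n) z).im) atTop (𝓝 (G z).im) := by
      have h3 : Tendsto (fun n : ℕ => z + ((1 / ((n : ℝ) + 1) : ℝ) : ℂ) * I) atTop (𝓝 z) := by
        have h4 := (continuous_ofReal.tendsto _).comp
          (tendsto_one_div_add_atTop_nhds_zero_nat (𝕜 := ℝ))
        simpa using (h4.mul_const I).const_add z
      have h4 := (hd.continuousOn.continuousAt (isOpen_upperHalfPlane.mem_nhds hz)).tendsto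
      refine ((continuous_im.tendsto _).comp (h4.comp h3)).congr fun n => ?_
      exact (hμim n z hz).symm
    exact eq_of_nhds_neBot (ClusterPt.mono h1 h2)
  -- Equal imaginary parts make the difference constant, and decay along the imaginary axis makes
  -- the constant zero.
  have hDA : AnalyticOnNhd ℂ (fun z => cauchyTransform ν z - G z) {z | 0 < z.im} :=
    DifferentiableOn.analyticOnNhd (DifferentiableOn.sub
      (fun w hw => (differentiableAt_cauchyTransform ν hw).differentiableWithinAt) hd)
      isOpen_upperHalfPlane
  obtain ⟨c, hc⟩ := hDA.eq_const_of_im_eq_const (c₀ := 0)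
    (fun z hz => by simp [hνim z hz]) isOpen_upperHalfPlane
    ⟨⟨I, by simp⟩, isPreconnected_upperHalfPlane⟩
  have hc0 : c = 0 := by
    have h1 : Tendsto (fun y : ℝ => 2 * y⁻¹) atTop (𝓝 0) := by
      simpa using tendsto_inv_atTop_zero.const_mul (2 : ℝ)
    have h2 : ∀ᶠ y : ℝ in atTop, ‖c‖ ≤ 2 * y⁻¹ := by
      filter_upwards [eventually_gt_atTop 0] with y hy
      have him' : ((y : ℂ) * I).im = y := by simp
      have hpos : 0 < ((y : ℂ) * I).im := by rw [him']; exact hy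
      rw [← hc _ hpos]
      refine (norm_sub_le _ _).trans
        ((add_le_add (norm_cauchyTransform_le ν hpos) (hb _ hpos)).trans (le_of_eq ?_))
      rw [him']
      ring
    exact norm_le_zero_iff.1 (ge_of_tendsto h1 h2)
  refine ⟨ν, fun z hz => ?_⟩
  have := hc z hz
  rw [hc0] at this
  exact sub_eq_zero.1 this

/-- A holomorphic self-map `F` of the upper half-plane with `Im z ≤ Im F(z)` and
`F(iy) / (iy) → 1` is the `F`-transform of a probability measure. -/
theorem exists_fTransform_eq {F : ℂ → ℂ} (hd : DifferentiableOn ℂ F {z | 0 < z.im})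
    (him : ∀ z : ℂ, 0 < z.im → z.im ≤ (F z).im)
    (hlim : Tendsto (fun y : ℝ => F (y * I) / (y * I)) atTop (𝓝 1)) :
    ∃ μ : ProbabilityMeasure ℝ, ∀ z : ℂ, 0 < z.im → fTransform μ z = F z := by
  have hne : ∀ z : ℂ, 0 < z.im → F z ≠ 0 := by
    intro z hz h
    have := him z hz
    rw [h, zero_im] at this
    linarith
  have hb : ∀ z : ℂ, 0 < z.im → ‖1 / F z‖ ≤ 1 / z.im := by
    intro z hz
    rw [norm_div, norm_one]
    exact one_div_le_one_div_of_le hz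
      ((him z hz).trans ((le_abs_self _).trans (abs_im_le_norm _)))
  have hi : ∀ z : ℂ, 0 < z.im → (1 / F z).im ≤ 0 := by
    intro z hz
    rw [one_div, inv_im]
    exact div_nonpos_of_nonpos_of_nonneg (by linarith [him z hz]) (normSq_nonneg _)
  have hl : Tendsto (fun y : ℝ => y * (1 / F (y * I)).im) atTop (𝓝 (-1)) := by
    have h1 := ((continuous_im.tendsto _).comp ((hlim.inv₀ one_ne_zero).mul_const (-I)))
    simp only [inv_one, one_mul, neg_im, I_im] at h1
    refine h1.congr fun y => ?_
    simp only [Function.comp_apply, inv_div]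
    rw [← im_ofReal_mul]
    congr 1
    rw [div_mul_eq_mul_div, mul_assoc, mul_neg, I_mul_I]
    ring
  obtain ⟨μ, hμ⟩ := exists_cauchyTransform_eq (G := fun z => 1 / F z)
    ((differentiableOn_const _).div hd hne) hb hi hl
  refine ⟨μ, fun z hz => ?_⟩
  rw [fTransform, hμ z hz, one_div_one_div]

/-! ### The `K`-transform in truncated cones -/

/-- The truncated cone `{w : |Re w| ≤ a Im w, Im w ≥ b}`. -/
def truncCone (a b : ℝ) : Set ℂ :=
  {w | |w.re| ≤ a * w.im ∧ b ≤ w.im}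

theorem convex_truncCone (a b : ℝ) : Convex ℝ (truncCone a b) := by
  have h : truncCone a b = {w : ℂ | (1 : ℝ) * w.re ≤ a * w.im} ∩ {w : ℂ | -w.re ≤ a * w.im} ∩
      {w : ℂ | b ≤ w.im} := by
    ext w
    simp only [truncCone, Set.mem_inter_iff, Set.mem_ofPred_eq, abs_le', one_mul]
  intro x hx y hy s t hs ht hst
  rw [h] at hx hy ⊢
  simp only [Set.mem_inter_iff, Set.mem_ofPred_eq, add_re, add_im, real_smul, re_ofReal_mul,
    im_ofReal_mul, one_mul] at hx hy ⊢
  obtain ⟨⟨hx1, hx2⟩, hx3⟩ := hx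
  obtain ⟨⟨hy1, hy2⟩, hy3⟩ := hy
  refine ⟨⟨?_, ?_⟩, ?_⟩
  · nlinarith [mul_le_mul_of_nonneg_left hx1 hs, mul_le_mul_of_nonneg_left hy1 ht]
  · nlinarith [mul_le_mul_of_nonneg_left hx2 hs, mul_le_mul_of_nonneg_left hy2 ht]
  · have : b = s * b + t * b := by rw [← add_mul, hst, one_mul]
    rw [this]
    exact add_le_add (mul_le_mul_of_nonneg_left hx3 hs) (mul_le_mul_of_nonneg_left hy3 ht)

theorem norm_le_of_mem_truncCone {a b : ℝ} (hb : 0 < b) {w : ℂ} (hw : w ∈ truncCone a b) :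
    ‖w‖ ≤ (a + 1) * w.im := by
  have h1 := norm_le_abs_re_add_abs_im w
  rw [abs_of_pos (hb.trans_le hw.2)] at h1
  linarith [hw.1]

theorem tendsto_integral_min_abs_div (μ : ProbabilityMeasure ℝ) {c : ℝ} (hc : 0 ≤ c) :
    Tendsto (fun y : ℝ => ∫ t : ℝ, min (|t| / y) c ∂(μ : Measure ℝ)) atTop (𝓝 0) := by
  have h : Tendsto (fun y : ℝ => ∫ t : ℝ, min (|t| / y) c ∂(μ : Measure ℝ)) atTop
      (𝓝 (∫ _t : ℝ, (0 : ℝ) ∂(μ : Measure ℝ))) := by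
    refine tendsto_integral_filter_of_dominated_convergence (fun _ => c)
      (Eventually.of_forall fun y => ?_) ?_ (integrable_const _) (ae_of_all _ fun t => ?_)
    · exact (by fun_prop : Measurable fun t : ℝ => min (|t| / y) c).aestronglyMeasurable
    · filter_upwards [eventually_gt_atTop 0] with y hy
      refine ae_of_all _ fun t => ?_
      rw [Real.norm_of_nonneg (le_min (by positivity) hc)]
      exact min_le_right _ _
    · have h1 : Tendsto (fun y : ℝ => |t| / y) atTop (𝓝 0) :=
        tendsto_const_nhds.div_atTop tendsto_id
      simpa [hc] using h1.min (tendsto_const_nhds (x := c))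
  simpa using h

/-- The integrand is `t / (w - t)`. It is at most `|t| / Im w`, and also at most `a + 2` because
`|w| ≤ (a+1) Im w ≤ (a+1)|w - t|`. The second bound allows dominated convergence without moments of
`μ`. -/
theorem norm_mul_cauchyTransform_sub_one_le (μ : ProbabilityMeasure ℝ) {a b : ℝ} (ha : 0 ≤ a)
    (hb : 0 < b) {w : ℂ} (hw : w ∈ truncCone a b) :
    ‖w * cauchyTransform μ w - 1‖ ≤ ∫ t : ℝ, min (|t| / w.im) (a + 2) ∂(μ : Measure ℝ) := by
  have hw0 : 0 < w.im := hb.trans_le hw.2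
  have h1 : w * cauchyTransform μ w - 1 =
      ∫ t : ℝ, (w * (1 / (w - (t : ℂ))) - 1) ∂(μ : Measure ℝ) := by
    rw [integral_sub ((integrable_one_div_sub_ofReal μ hw0).const_mul w) (integrable_const _),
      integral_const_mul]
    simp [cauchyTransform]
  rw [h1]
  refine norm_integral_le_of_norm_le ?_ (ae_of_all _ fun t => ?_)
  · refine Integrable.of_bound
      (by fun_prop : Measurable fun t : ℝ => min (|t| / w.im) (a + 2)).aestronglyMeasurable (a + 2)
      (ae_of_all _ fun t => ?_)
    rw [Real.norm_of_nonneg (le_min (by positivity) (by positivity))]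
    exact min_le_right _ _
  · have hne := sub_ofReal_ne_zero hw0 t
    have hpos := norm_pos_iff.2 hne
    have h2 : w * (1 / (w - (t : ℂ))) - 1 = t / (w - t) := by
      field_simp
      ring
    have him := im_le_norm_sub_ofReal w t
    rw [h2, norm_div, norm_real, Real.norm_eq_abs]
    refine le_min (div_le_div_of_nonneg_left (abs_nonneg t) hw0 him) ?_
    rw [div_le_iff₀ hpos]
    have h3 : |t| ≤ ‖w‖ + ‖w - t‖ := by
      have := norm_sub_le w (w - t)
      rwa [sub_sub_cancel, norm_real, Real.norm_eq_abs] at this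
    have h4 := norm_le_of_mem_truncCone hb hw
    have h5 := mul_le_mul_of_nonneg_left him (by linarith : 0 ≤ a + 1)
    linarith

theorem eventually_norm_kTransform_le (μ : ProbabilityMeasure ℝ) {a η : ℝ} (ha : 0 ≤ a)
    (hη : 0 < η) :
    ∀ᶠ b in atTop, ∀ w ∈ truncCone a b, ‖kTransform μ w‖ ≤ η * ‖w‖ := by
  have hδ : 0 < min (1 / 2) (η / 2) := by positivity
  have h1 := (tendsto_integral_min_abs_div μ (c := a + 2) (by positivity)).eventually_le_const hδ
  filter_upwards [eventually_forall_ge_atTop.2 h1, eventually_gt_atTop 0] with b hb hb0 w hw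
  have hw0 : 0 < w.im := hb0.trans_le hw.2
  have h2 := (norm_mul_cauchyTransform_sub_one_le μ ha hb0 hw).trans (hb _ hw.2)
  have hG := cauchyTransform_ne_zero μ hw0
  have hwne : w ≠ 0 := by rintro rfl; simp at hw0
  have hK : kTransform μ w = w * (w * cauchyTransform μ w - 1) / (w * cauchyTransform μ w) := by
    rw [kTransform, fTransform]
    field_simp
  have h3 : 1 / 2 ≤ ‖w * cauchyTransform μ w‖ := by
    have h4 := norm_sub_norm_le (1 : ℂ) (1 - w * cauchyTransform μ w)
    rw [sub_sub_cancel, norm_one, norm_sub_rev] at h4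
    linarith [min_le_left (1 / 2) (η / 2)]
  rw [hK, norm_div, norm_mul, div_le_iff₀ (by linarith)]
  have h5 : ‖w * cauchyTransform μ w - 1‖ ≤ η * ‖w * cauchyTransform μ w‖ := by
    have := mul_le_mul_of_nonneg_left h3 hη.le
    linarith [min_le_right (1 / 2) (η / 2)]
  calc ‖w‖ * ‖w * cauchyTransform μ w - 1‖ ≤ ‖w‖ * (η * ‖w * cauchyTransform μ w‖) :=
        mul_le_mul_of_nonneg_left h5 (norm_nonneg _)
    _ = _ := by ring

/-- Cauchy's estimate on the disc of radius `Im x / 2` about `x` turns the size bound into a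
derivative bound; the cone is convex. The disc lies in the cone of aperture `2a + 1` and height `b /
2`, and its points have norm at most `(a + 2) Im x`, whence the constants. -/
theorem eventually_norm_kTransform_sub_le (μ : ProbabilityMeasure ℝ) {a η : ℝ} (ha : 0 ≤ a)
    (hη : 0 < η) :
    ∀ᶠ b in atTop, ∀ w ∈ truncCone a b, ∀ w' ∈ truncCone a b,
      ‖kTransform μ w - kTransform μ w'‖ ≤ η * ‖w - w'‖ := by
  have hη' : 0 < η / (2 * (a + 2)) := by positivity
  have h1 := eventually_norm_kTransform_le μ (a := 2 * a + 1) (by positivity) hη'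
  have h2 : Tendsto (fun b : ℝ => b / 2) atTop atTop := tendsto_id.atTop_div_const two_pos
  filter_upwards [h2.eventually h1, eventually_gt_atTop 0] with b hb hb0 w hw w' hw'
  have hder : ∀ x ∈ truncCone a b, ‖deriv (kTransform μ) x‖ ≤ η := by
    intro x hx
    have hx0 : 0 < x.im := hb0.trans_le hx.2
    have hball : ∀ v : ℂ, ‖v - x‖ ≤ x.im / 2 → v ∈ truncCone (2 * a + 1) (b / 2) := by
      intro v hv
      have hre := (abs_re_le_norm (v - x)).trans hv
      have him := (abs_im_le_norm (v - x)).trans hv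
      rw [sub_re, abs_le] at hre
      rw [sub_im, abs_le] at him
      have hxre := abs_le.1 hx.1
      have hv2 : x.im / 2 ≤ v.im := by linarith
      refine ⟨abs_le.2 ⟨?_, ?_⟩, by linarith [hx.2]⟩ <;> nlinarith
    have hbound : ∀ v : ℂ, ‖v - x‖ ≤ x.im / 2 → ‖kTransform μ v‖ ≤ η / 2 * x.im := by
      intro v hv
      refine (hb v (hball v hv)).trans ?_
      have h3 : ‖v‖ ≤ (a + 2) * x.im := by
        have := norm_le_of_mem_truncCone hb0 hx
        have h4 := norm_add_le (v - x) x
        rw [sub_add_cancel] at h4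
        linarith
      calc η / (2 * (a + 2)) * ‖v‖ ≤ η / (2 * (a + 2)) * ((a + 2) * x.im) :=
            mul_le_mul_of_nonneg_left h3 hη'.le
        _ = η / 2 * x.im := by field_simp
    have hdc : DiffContOnCl ℂ (kTransform μ) (Metric.ball x (x.im / 2)) := by
      refine DifferentiableOn.diffContOnCl fun v hv => ?_
      have hv' := Metric.closure_ball_subset_closedBall hv
      rw [mem_closedBall_iff_norm] at hv'
      exact (differentiableAt_kTransform μ
        ((half_pos hb0).trans_le (hball v hv').2)).differentiableWithinAt
    have h5 := norm_deriv_le_of_forall_mem_sphere_norm_le (half_pos hx0) hdc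
      fun v hv => hbound v (mem_sphere_iff_norm.1 hv).le
    refine h5.trans (le_of_eq ?_)
    field_simp
  exact (convex_truncCone a b).norm_image_sub_le_of_norm_deriv_le
    (fun x hx => differentiableAt_kTransform μ (hb0.trans_le hx.2)) hder hw' hw

/-- Inner arguments of the recursion leave the cone of aperture `1` but stay in that of aperture
`2`, so the estimates on `K_{μ_j}` are used there. -/
theorem sub_mem_truncCone {b : ℝ} {z k : ℂ} (hz : z ∈ truncCone 1 b)
    (him : k.im ≤ 0) (hk : ‖k‖ ≤ z.im) : z - k ∈ truncCone 2 b := by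
  have hre := (abs_re_le_norm k).trans hk
  refine ⟨?_, ?_⟩
  · rw [sub_re, sub_im]
    refine (abs_sub _ _).trans ?_
    linarith [hz.1]
  · rw [sub_im]
    linarith [hz.2]

/-! ### Convergence in terms of the `K`-transform -/

theorem truncCone_mem_nhds {b : ℝ} (hb : 0 < b) : truncCone 1 b ∈ 𝓝 (((2 * b : ℝ) : ℂ) * I) := by
  have h1 : ∀ᶠ w in 𝓝 (((2 * b : ℝ) : ℂ) * I), |w.re| < 1 * w.im :=
    (isOpen_lt (continuous_abs.comp continuous_re) (continuous_const.mul continuous_im)).mem_nhds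
      (by simpa using hb)
  have h2 : ∀ᶠ w in 𝓝 (((2 * b : ℝ) : ℂ) * I), b < w.im :=
    (isOpen_lt continuous_const continuous_im).mem_nhds (by simpa using by linarith)
  filter_upwards [h1, h2] with w hw1 hw2 using ⟨hw1.le, hw2.le⟩

/-- At `z = iy` one has `z G - 1 = K / F` with `|F| ≥ y`, so smallness of `K / y` controls the tail.
-/
theorem isTightMeasureSet_of_kTransform {ι : Type*} {μ : ι → ProbabilityMeasure ℝ}
    (h : ∀ δ : ℝ, 0 < δ → ∃ y : ℝ, 0 < y ∧ ∀ i, ‖kTransform (μ i) (y * I)‖ ≤ δ * y) :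
    IsTightMeasureSet {((m : ProbabilityMeasure ℝ) : Measure ℝ) | m ∈ Set.range μ} := by
  refine isTightMeasureSet_of_cauchyTransform fun δ hδ => ?_
  obtain ⟨y, hy, hK⟩ := h δ hδ
  refine ⟨y, hy, fun i => ?_⟩
  have him : ((y : ℂ) * I).im = y := by simp
  have hpos : 0 < ((y : ℂ) * I).im := by rw [him]; exact hy
  have hG := cauchyTransform_ne_zero (μ i) hpos
  have hF : y ≤ ‖fTransform (μ i) (y * I)‖ := by
    have h1 := im_le_im_fTransform (μ i) hpos
    rw [him] at h1
    exact h1.trans ((le_abs_self _).trans (abs_im_le_norm _))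
  have hF0 : fTransform (μ i) (y * I) ≠ 0 := norm_pos_iff.1 (hy.trans_le hF)
  have h2 : y * I * cauchyTransform (μ i) (y * I) - 1 =
      kTransform (μ i) (y * I) / fTransform (μ i) (y * I) := by
    rw [kTransform, fTransform]
    field_simp
  have h3 : 1 + y * (cauchyTransform (μ i) (y * I)).im =
      -(y * I * cauchyTransform (μ i) (y * I) - 1).re := by
    rw [mul_assoc, sub_re, re_ofReal_mul]
    simp
  rw [h3]
  refine ((neg_le_abs _).trans (abs_re_le_norm _)).trans ?_
  rw [h2, norm_div, div_le_iff₀ (hy.trans_le hF)]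
  exact (hK i).trans (mul_le_mul_of_nonneg_left hF hδ.le)

theorem exists_tendsto_of_tendsto_kTransform {ι : Type*} {l : Filter ι} [l.NeBot]
    {μ : ι → ProbabilityMeasure ℝ}
    (ht : IsTightMeasureSet {((m : ProbabilityMeasure ℝ) : Measure ℝ) | m ∈ Set.range μ})
    {z₀ : ℂ} (hz₀ : 0 < z₀.im)
    (hg : ∀ᶠ z in 𝓝 z₀, ∃ k, Tendsto (fun i => kTransform (μ i) z) l (𝓝 k)) :
    ∃ ν, Tendsto μ l (𝓝 ν) := by
  have hg' : ∀ᶠ z in 𝓝 z₀, ∃ c, Tendsto (fun i => cauchyTransform (μ i) z) l (𝓝 c) := by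
    filter_upwards [hg, isOpen_upperHalfPlane.mem_nhds hz₀] with z ⟨k, hk⟩ hz
    have hF : Tendsto (fun i => fTransform (μ i) z) l (𝓝 (z - k)) := by
      simp_rw [← sub_kTransform]
      exact hk.const_sub z
    -- The bound `Im F ≥ Im z` survives the limit, so the limit of `F` is nonzero and can be
    -- inverted.
    have him : z.im ≤ (z - k).im :=
      ge_of_tendsto ((continuous_im.tendsto _).comp hF)
        (Eventually.of_forall fun i => im_le_im_fTransform (μ i) hz)
    have hne : z - k ≠ 0 := by
      intro h0
      rw [h0, zero_im] at him
      exact absurd hz (not_lt.2 him)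
    refine ⟨(z - k)⁻¹, (hF.inv₀ hne).congr fun i => ?_⟩
    rw [fTransform, one_div, inv_inv]
  obtain ⟨g, hg''⟩ : ∃ g : ℂ → ℂ, ∀ᶠ z in 𝓝 z₀,
      Tendsto (fun i => cauchyTransform (μ i) z) l (𝓝 (g z)) := by
    classical
    refine ⟨fun z => if h : ∃ c, Tendsto (fun i => cauchyTransform (μ i) z) l (𝓝 c)
      then h.choose else 0, ?_⟩
    filter_upwards [hg'] with z hz
    rw [dif_pos hz]
    exact hz.choose_spec
  exact exists_tendsto_of_tendsto_cauchyTransform ht hz₀ hg''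

theorem tendsto_of_tendsto_kTransform {ι : Type*} {l : Filter ι} [l.NeBot]
    {μ : ι → ProbabilityMeasure ℝ} {ν : ProbabilityMeasure ℝ}
    (ht : IsTightMeasureSet {((m : ProbabilityMeasure ℝ) : Measure ℝ) | m ∈ Set.range μ})
    {z₀ : ℂ} (hz₀ : 0 < z₀.im)
    (hg : ∀ᶠ z in 𝓝 z₀, Tendsto (fun i => kTransform (μ i) z) l (𝓝 (kTransform ν z))) :
    Tendsto μ l (𝓝 ν) := by
  obtain ⟨ν', hν'⟩ := exists_tendsto_of_tendsto_kTransform ht hz₀ (hg.mono fun z hz => ⟨_, hz⟩)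
  have heq : ν' = ν := by
    refine eq_of_cauchyTransform_eventuallyEq hz₀ ?_
    filter_upwards [hg, isOpen_upperHalfPlane.mem_nhds hz₀] with z hz hzim
    exact cauchyTransform_eq_of_kTransform_eq
      (tendsto_nhds_unique (((continuous_kTransform_measure hzim).tendsto ν').comp hν') hz)
  exact heq ▸ hν'

/-! ### One step of the construction -/

theorem tendsto_kTransform_comp_div (μ ν : ProbabilityMeasure ℝ) :
    Tendsto (fun y : ℝ => kTransform μ (y * I - kTransform ν (y * I)) / (y * I)) atTop (𝓝 0) := by
  rw [NormedAddGroup.tendsto_nhds_zero]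
  intro ε hε
  have h1 := eventually_norm_kTransform_le ν (a := 1) zero_le_one zero_lt_one
  have h2 := eventually_norm_kTransform_le μ (a := 2) zero_le_two (η := ε / 3) (by positivity)
  filter_upwards [h1, h2, eventually_gt_atTop 0] with y hν hμ hy
  have him : ((y : ℂ) * I).im = y := by simp
  have hz : (y : ℂ) * I ∈ truncCone 1 y := ⟨by simpa using hy.le, by simp⟩
  have hpos : 0 < ((y : ℂ) * I).im := by rw [him]; exact hy
  have hnorm : ‖(y : ℂ) * I‖ = y := by simp [abs_of_pos hy]
  have hK := hν _ hz
  rw [hnorm, one_mul] at hK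
  have hw := hμ _ (sub_mem_truncCone hz (kTransform_im_nonpos ν hpos) (by rwa [him]))
  have hs := norm_sub_le ((y : ℂ) * I) (kTransform ν (y * I))
  rw [hnorm] at hs
  rw [norm_div, hnorm, div_lt_iff₀ hy]
  refine hw.trans_lt ?_
  have : ε / 3 * ‖(y : ℂ) * I - kTransform ν (y * I)‖ ≤ ε / 3 * (y + y) := by
    gcongr
    linarith
  nlinarith

/-- Each summand is holomorphic, has nonpositive imaginary part and is `o(y)` at `iy`, so `z` minus
the sum meets the criterion for `F`-transforms. -/
theorem exists_kTransform_eq_sum {ι : Type*} (s : Finset ι) (μ ν : ι → ProbabilityMeasure ℝ) :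
    ∃ m : ProbabilityMeasure ℝ, ∀ z : ℂ, 0 < z.im →
      kTransform m z = ∑ j ∈ s, kTransform (μ j) (z - kTransform (ν j) z) := by
  have hpos : ∀ (z : ℂ), 0 < z.im → ∀ j, 0 < (z - kTransform (ν j) z).im :=
    fun z hz j => hz.trans_le (im_le_im_sub_kTransform (ν j) hz)
  have hd : DifferentiableOn ℂ
      (fun z => z - ∑ j ∈ s, kTransform (μ j) (z - kTransform (ν j) z)) {z | 0 < z.im} := by
    intro z hz
    refine (differentiableAt_id.sub (DifferentiableAt.fun_sum fun j _ => ?_)).differentiableWithinAt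
    exact DifferentiableAt.comp z (g := kTransform (μ j))
      (f := fun z => z - kTransform (ν j) z) (differentiableAt_kTransform (μ j) (hpos z hz j))
      (differentiableAt_id.sub (differentiableAt_kTransform (ν j) hz))
  have him : ∀ z : ℂ, 0 < z.im →
      z.im ≤ (z - ∑ j ∈ s, kTransform (μ j) (z - kTransform (ν j) z)).im := by
    intro z hz
    rw [sub_im, im_sum]
    have := Finset.sum_nonpos fun j (_ : j ∈ s) => kTransform_im_nonpos (μ j) (hpos z hz j)
    linarith
  have hlim : Tendsto (fun y : ℝ => (y * I - ∑ j ∈ s,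
      kTransform (μ j) (y * I - kTransform (ν j) (y * I))) / (y * I)) atTop (𝓝 1) := by
    have h1 : Tendsto (fun y : ℝ => 1 - ∑ j ∈ s,
        kTransform (μ j) (y * I - kTransform (ν j) (y * I)) / (y * I)) atTop (𝓝 1) := by
      have := (tendsto_finsetSum s fun j _ => tendsto_kTransform_comp_div (μ j) (ν j)).const_sub
        (1 : ℂ)
      simpa using this
    refine h1.congr' ?_
    filter_upwards [eventually_gt_atTop 0] with y hy
    have hne : (y : ℂ) * I ≠ 0 := mul_ne_zero (ofReal_ne_zero.2 hy.ne') I_ne_zero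
    rw [sub_div, div_self hne, Finset.sum_div]
  obtain ⟨m, hm⟩ := exists_fTransform_eq hd him hlim
  refine ⟨m, fun z hz => ?_⟩
  rw [kTransform, hm z hz, sub_sub_cancel]

theorem exists_kTransform_eq_zero :
    ∃ m : ProbabilityMeasure ℝ, ∀ z : ℂ, 0 < z.im → kTransform m z = 0 := by
  simpa using exists_kTransform_eq_sum (∅ : Finset Empty) Empty.elim Empty.elim

namespace RootedTree

variable {N N' : ℕ}

/-! ### Truncations of rooted trees -/

theorem mem_branch {T : RootedTree N} {j : Fin N} {hj : [j] ∈ T.verts} {s : List (Fin N)} :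
    s ∈ (T.branch j hj).verts ↔ s ++ [j] ∈ T.verts :=
  Iff.rfl

theorem mem_map {T : RootedTree N} {ψ : Fin N → Fin N'}
    {h : ∀ s ∈ T.verts, IsAlternating (s.map ψ)} {t : List (Fin N')} :
    t ∈ (T.map ψ h).verts ↔ ∃ s ∈ T.verts, s.map ψ = t :=
  Iff.rfl

theorem suffix_mem (T : RootedTree N) {t s : List (Fin N)} (h : t ++ s ∈ T.verts) :
    s ∈ T.verts := by
  induction t with
  | nil => exact h
  | cons j t ih => exact ih (T.parent_mem h)

theorem ball_eq_iff {T T' : RootedTree N} {m : ℕ} :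
    T.ball m = T'.ball m ↔ ∀ s : List (Fin N), s.length ≤ m → (s ∈ T.verts ↔ s ∈ T'.verts) := by
  simp only [ball, Set.ext_iff, Set.mem_ofPred_eq, and_congr_left_iff]

theorem ball_branch_eq {T T' : RootedTree N} {m : ℕ} (h : T.ball (m + 1) = T'.ball (m + 1))
    {j : Fin N} (hj : [j] ∈ T.verts) (hj' : [j] ∈ T'.verts) :
    (T.branch j hj).ball m = (T'.branch j hj').ball m := by
  rw [ball_eq_iff] at h ⊢
  intro s hs
  rw [mem_branch, mem_branch]
  exact h _ (by simpa using hs)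

theorem eventually_ball_eq (T : RootedTree N) (m : ℕ) :
    ∀ᶠ T' in 𝓝 T, T'.ball m = T.ball m := by
  filter_upwards [Metric.ball_mem_nhds T (Real.exp_pos (-(m : ℝ)))] with T' hT'
  by_cases heq : T' = T
  · rw [heq]
  have h1 : rho T' T < Real.exp (-(m : ℝ)) := hT'
  rw [rho, if_neg heq, Real.exp_lt_exp, neg_lt_neg_iff, Nat.cast_lt] at h1
  exact agreeLevels_mono h1.le (Nat.sSup_mem (agreeLevels_nonempty T' T) (agreeLevels_bddAbove heq))

theorem dist_le_of_ball_eq {T T' : RootedTree N} {m : ℕ} (h : T.ball m = T'.ball m) :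
    dist T T' ≤ Real.exp (-(m : ℝ)) := by
  change rho T T' ≤ _
  by_cases heq : T = T'
  · rw [rho, if_pos heq]
    exact (Real.exp_pos _).le
  · rw [rho, if_neg heq, Real.exp_le_exp, neg_le_neg_iff, Nat.cast_le]
    exact le_csSup (agreeLevels_bddAbove heq) h

/-- The truncation of a rooted tree to the strings of length at most `m`. -/
def trunc (T : RootedTree N) (m : ℕ) : RootedTree N :=
  ofParentClosed (T.ball m) (fun s hs => T.alternating s hs.1) ⟨T.root_mem, Nat.zero_le m⟩
    fun _ _ hs => ⟨T.parent_mem hs.1, (Nat.le_succ _).trans hs.2⟩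

theorem mem_trunc {T : RootedTree N} {m : ℕ} {s : List (Fin N)} :
    s ∈ (T.trunc m).verts ↔ s ∈ T.verts ∧ s.length ≤ m :=
  Iff.rfl

theorem tendsto_trunc (T : RootedTree N) : Tendsto T.trunc atTop (𝓝 T) := by
  rw [tendsto_iff_dist_tendsto_zero]
  refine squeeze_zero (fun _ => dist_nonneg) (fun m => dist_le_of_ball_eq (m := m) ?_)
    (Real.tendsto_exp_neg_atTop_nhds_zero.comp tendsto_natCast_atTop_atTop)
  rw [ball_eq_iff]
  intro s hs
  rw [mem_trunc, and_iff_left hs]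

/-! ### Images of rooted trees -/

theorem Compatible.mono {T T' : RootedTree N} {ψ : Fin N → Fin N'} (h : T.Compatible ψ)
    (hsub : T'.verts ⊆ T.verts) : T'.Compatible ψ :=
  ⟨fun s hs => h.alternating s (hsub hs), h.injOn.mono hsub⟩

theorem trunc_map {T : RootedTree N} {ψ : Fin N → Fin N'} (h : T.Compatible ψ) (m : ℕ)
    (h' : (T.trunc m).Compatible ψ) :
    (T.trunc m).map ψ h'.alternating = (T.map ψ h.alternating).trunc m := by
  ext t
  simp only [mem_map, mem_trunc]
  constructor
  · rintro ⟨s, ⟨hs, hsm⟩, rfl⟩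
    exact ⟨⟨s, hs, rfl⟩, by simpa using hsm⟩
  · rintro ⟨⟨s, hs, rfl⟩, hsm⟩
    exact ⟨s, ⟨hs, by simpa using hsm⟩, rfl⟩

theorem Compatible.branch {T : RootedTree N} {ψ : Fin N → Fin N'} (h : T.Compatible ψ)
    {j : Fin N} (hj : [j] ∈ T.verts) : (T.branch j hj).Compatible ψ where
  alternating s hs := by
    have h1 := h.alternating _ (mem_branch.1 hs)
    rw [List.map_append] at h1
    exact (List.isChain_append.1 h1).1
  injOn s hs t ht hst := by
    have h1 := h.injOn (mem_branch.1 hs) (mem_branch.1 ht) (by simp [hst])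
    exact List.append_cancel_right h1

theorem Compatible.eq_of_singleton_mem {T : RootedTree N} {ψ : Fin N → Fin N'}
    (h : T.Compatible ψ) {i j : Fin N} (hi : [i] ∈ T.verts) (hj : [j] ∈ T.verts)
    (hij : ψ i = ψ j) : i = j := by
  simpa using h.injOn hi hj (by simp [hij])

theorem singleton_mem_map {T : RootedTree N} {ψ : Fin N → Fin N'}
    {h : ∀ s ∈ T.verts, IsAlternating (s.map ψ)} {k : Fin N'} :
    [k] ∈ (T.map ψ h).verts ↔ ∃ j, [j] ∈ T.verts ∧ ψ j = k := by
  rw [mem_map]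
  constructor
  · rintro ⟨s, hs, hsk⟩
    obtain ⟨j, rfl, hj⟩ := List.map_eq_singleton_iff.1 hsk
    exact ⟨j, hs, hj⟩
  · rintro ⟨j, hj, rfl⟩
    exact ⟨[j], hj, rfl⟩

/-- A string of `T` whose image ends in `ψ j` ends in some `i` with `ψ i = ψ j`; its suffix `[i]`
lies in `T`, so injectivity on one-letter strings forces `i = j`. -/
theorem branch_map {T : RootedTree N} {ψ : Fin N → Fin N'} (h : T.Compatible ψ) {j : Fin N}
    (hj : [j] ∈ T.verts) (hj' : [ψ j] ∈ (T.map ψ h.alternating).verts) :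
    (T.map ψ h.alternating).branch (ψ j) hj' =
      (T.branch j hj).map ψ (h.branch hj).alternating := by
  ext t
  simp only [mem_branch, mem_map]
  constructor
  · rintro ⟨r, hr, hrt⟩
    obtain ⟨s, u, rfl, rfl, hu⟩ := List.map_eq_append_iff.1 hrt
    obtain ⟨i, rfl, hi⟩ := List.map_eq_singleton_iff.1 hu
    obtain rfl := h.eq_of_singleton_mem (T.suffix_mem hr) hj hi
    exact ⟨s, hr, rfl⟩
  · rintro ⟨s, hs, rfl⟩
    exact ⟨s ++ [j], hs, by simp⟩

end RootedTree

/-! ### Uniqueness and the convolution identity -/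

section Identity

variable {N N' : ℕ}
  {conv : RootedTree N → (Fin N → ProbabilityMeasure ℝ) → ProbabilityMeasure ℝ}
  {conv' : RootedTree N' → (Fin N' → ProbabilityMeasure ℝ) → ProbabilityMeasure ℝ}

/-- The sum over letters is grouped by the fibres of `ψ`. A fibre contains at most one letter of
`T`, and branches at that letter have smaller height. At height `0` both sums vanish. -/
theorem IsTreeConvolution.map_eq_of_length_le (hconv : IsTreeConvolution conv)
    (hconv' : IsTreeConvolution conv') (ψ : Fin N → Fin N') (μ : Fin N' → ProbabilityMeasure ℝ)
    (m : ℕ) : ∀ (T : RootedTree N) (hT : T.Compatible ψ), (∀ s ∈ T.verts, s.length ≤ m) →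
      conv T (fun j => μ (ψ j)) = conv' (T.map ψ hT.alternating) μ := by
  classical
  induction m with
  | zero =>
    intro T hT hm
    refine eq_of_kTransform_eq fun z hz => ?_
    have h1 : ∀ j, [j] ∉ T.verts := fun j hj => by simpa using hm _ hj
    have h2 : ∀ k, [k] ∉ (T.map ψ hT.alternating).verts := by
      intro k hk
      obtain ⟨j, hj, -⟩ := RootedTree.singleton_mem_map.1 hk
      exact h1 j hj
    rw [hconv.fixedPoint T _ z hz, hconv'.fixedPoint _ μ z hz]
    simp [h1, h2]
  | succ m ih =>
    intro T hT hm
    refine eq_of_kTransform_eq fun z hz => ?_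
    rw [hconv.fixedPoint T _ z hz, hconv'.fixedPoint _ μ z hz,
      ← Finset.sum_fiberwise Finset.univ ψ]
    refine Finset.sum_congr rfl fun k _ => ?_
    by_cases hk : [k] ∈ (T.map ψ hT.alternating).verts
    · rw [dif_pos hk]
      obtain ⟨j, hj, rfl⟩ := RootedTree.singleton_mem_map.1 hk
      rw [Finset.sum_eq_single j, dif_pos hj, RootedTree.branch_map hT hj hk,
        ih (T.branch j hj) (hT.branch hj)]
      · intro s hs
        simpa using hm _ (RootedTree.mem_branch.1 hs)
      · intro i hi hij
        rw [dif_neg]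
        exact fun hi' => hij (hT.eq_of_singleton_mem hi' hj (Finset.mem_filter.1 hi).2)
      · intro h
        exact (h (Finset.mem_filter.2 ⟨Finset.mem_univ j, rfl⟩)).elim
    · rw [dif_neg hk]
      refine Finset.sum_eq_zero fun i hi => dif_neg fun hi' => hk ?_
      exact RootedTree.singleton_mem_map.2 ⟨i, hi', (Finset.mem_filter.1 hi).2⟩

theorem IsTreeConvolution.map_eq (hconv : IsTreeConvolution conv)
    (hconv' : IsTreeConvolution conv') (ψ : Fin N → Fin N') (T : RootedTree N)
    (hT : T.Compatible ψ) (μ : Fin N' → ProbabilityMeasure ℝ) :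
    conv T (fun j => μ (ψ j)) = conv' (T.map ψ hT.alternating) μ := by
  have hc : ∀ m, (T.trunc m).Compatible ψ := fun m => hT.mono fun s hs => hs.1
  have h1 := ((hconv.continuous fun j => μ (ψ j)).tendsto T).comp T.tendsto_trunc
  have h2 := ((hconv'.continuous μ).tendsto (T.map ψ hT.alternating)).comp
    (T.map ψ hT.alternating).tendsto_trunc
  refine tendsto_nhds_unique h1 (h2.congr fun m => ?_)
  simp only [Function.comp_apply]
  rw [← RootedTree.trunc_map hT m (hc m)]
  exact (hconv.map_eq_of_length_le hconv' ψ μ m _ (hc m) fun s hs => hs.2).symm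

theorem IsTreeConvolution.unique
    {conv₁ conv₂ : RootedTree N → (Fin N → ProbabilityMeasure ℝ) → ProbabilityMeasure ℝ}
    (h₁ : IsTreeConvolution conv₁) (h₂ : IsTreeConvolution conv₂) : conv₁ = conv₂ := by
  ext1 T
  ext1 μ
  have hT : T.Compatible id :=
    ⟨fun s hs => by simpa using T.alternating s hs, fun s _ t _ hst => by simpa using hst⟩
  have hmap : T.map id hT.alternating = T := by
    ext t
    simp [RootedTree.mem_map]
  have h := h₁.map_eq h₂ id T hT μ
  rw [hmap] at h
  exact h

end Identity

/-! ### Existence -/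

section Existence

variable {N : ℕ}

open Classical in
theorem exists_kTransform_eq_sum_dite (p : Fin N → Prop) (μ : Fin N → ProbabilityMeasure ℝ)
    (ν : ∀ j, p j → ProbabilityMeasure ℝ) :
    ∃ m : ProbabilityMeasure ℝ, ∀ z : ℂ, 0 < z.im → kTransform m z =
      ∑ j : Fin N, if hj : p j then kTransform (μ j) (z - kTransform (ν j hj) z) else 0 := by
  obtain ⟨m, hm⟩ := exists_kTransform_eq_sum (Finset.univ.filter p) μ
    (fun j => if hj : p j then ν j hj else μ j)
  refine ⟨m, fun z hz => ?_⟩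
  rw [hm z hz, Finset.sum_filter]
  refine Finset.sum_congr rfl fun j _ => ?_
  by_cases hj : p j <;> simp [hj]

/-- The approximation of the tree convolution obtained from `n` steps of the recursion. -/
def approx (μ : Fin N → ProbabilityMeasure ℝ) : ℕ → RootedTree N → ProbabilityMeasure ℝ
  | 0, _ => exists_kTransform_eq_zero.choose
  | n + 1, T => (exists_kTransform_eq_sum_dite (fun j => [j] ∈ T.verts) μ
      fun j hj => approx μ n (T.branch j hj)).choose

theorem kTransform_approx_zero (μ : Fin N → ProbabilityMeasure ℝ) (T : RootedTree N) {z : ℂ}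
    (hz : 0 < z.im) : kTransform (approx μ 0 T) z = 0 :=
  exists_kTransform_eq_zero.choose_spec z hz

open Classical in
theorem kTransform_approx_succ (μ : Fin N → ProbabilityMeasure ℝ) (n : ℕ) (T : RootedTree N)
    {z : ℂ} (hz : 0 < z.im) :
    kTransform (approx μ (n + 1) T) z = ∑ j : Fin N, if hj : [j] ∈ T.verts then
      kTransform (μ j) (z - kTransform (approx μ n (T.branch j hj)) z) else 0 :=
  (exists_kTransform_eq_sum_dite (fun j => [j] ∈ T.verts) μ
      fun j hj => approx μ n (T.branch j hj)).choose_spec z hz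

/-- The bound reproduces itself: with `δ ≤ 1` the inner arguments lie in the cone of aperture `2`
and have norm at most `3 Im z`, so `N` terms with constant `δ / (3(N+1))` sum to at most `δ Im z`.
The height `b` is fixed before the depth and the tree. -/
theorem eventually_norm_kTransform_approx_le (μ : Fin N → ProbabilityMeasure ℝ) {δ : ℝ}
    (hδ : 0 < δ) (hδ1 : δ ≤ 1) :
    ∀ᶠ b in atTop, ∀ n T, ∀ z ∈ truncCone 1 b, ‖kTransform (approx μ n T) z‖ ≤ δ * z.im := by
  classical
  have hη : 0 < δ / (3 * (N + 1)) := by positivity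
  have h1 : ∀ᶠ b in atTop, ∀ j, ∀ w ∈ truncCone 2 b,
      ‖kTransform (μ j) w‖ ≤ δ / (3 * (N + 1)) * ‖w‖ :=
    eventually_all.2 fun j => eventually_norm_kTransform_le (μ j) zero_le_two hη
  filter_upwards [h1, eventually_gt_atTop 0] with b hb hb0 n
  induction n with
  | zero =>
    intro T z hz
    have hz0 := hb0.trans_le hz.2
    rw [kTransform_approx_zero μ T hz0, norm_zero]
    positivity
  | succ n ih =>
    intro T z hz
    have hz0 := hb0.trans_le hz.2
    rw [kTransform_approx_succ μ n T hz0]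
    have hterm : ∀ j ∈ (Finset.univ : Finset (Fin N)), ‖(if hj : [j] ∈ T.verts then
        kTransform (μ j) (z - kTransform (approx μ n (T.branch j hj)) z) else 0 : ℂ)‖ ≤
        δ / (3 * (N + 1)) * (3 * z.im) := by
      intro j _
      split_ifs with hj
      · have hk := ih (T.branch j hj) z hz
        have hk' : ‖kTransform (approx μ n (T.branch j hj)) z‖ ≤ z.im :=
          hk.trans (mul_le_of_le_one_left hz0.le hδ1)
        refine (hb j _ (sub_mem_truncCone hz (kTransform_im_nonpos _ hz0) hk')).trans ?_
        gcongr
        refine (norm_sub_le _ _).trans ?_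
        linarith [norm_le_of_mem_truncCone hb0 hz]
      · rw [norm_zero]
        positivity
    refine (norm_sum_le_of_le _ hterm).trans ?_
    rw [Finset.sum_const, Finset.card_univ, Fintype.card_fin, nsmul_eq_mul]
    calc (N : ℝ) * (δ / (3 * (N + 1)) * (3 * z.im)) = (N / (N + 1)) * (δ * z.im) := by
          field_simp
      _ ≤ δ * z.im := mul_le_of_le_one_left (by positivity)
          ((div_le_one (by positivity)).2 (by linarith))

/-- One recursion step spends one level of agreement and gains the factor `N / (2(N+1)) ≤ 1/2`. At
`m = 0` both terms are simply at most `Im z`. -/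
theorem eventually_norm_kTransform_approx_sub_le (μ : Fin N → ProbabilityMeasure ℝ) :
    ∀ᶠ b in atTop, ∀ m : ℕ, ∀ k l, m ≤ k → m ≤ l → ∀ T T' : RootedTree N, T.ball m = T'.ball m →
      ∀ z ∈ truncCone 1 b, ‖kTransform (approx μ k T) z - kTransform (approx μ l T') z‖ ≤
        (1 / 2) ^ m * (2 * z.im) := by
  classical
  have hη : (0 : ℝ) < 1 / (2 * (N + 1)) := by positivity
  have h1 : ∀ᶠ b in atTop, ∀ j, ∀ w ∈ truncCone 2 b, ∀ w' ∈ truncCone 2 b,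
      ‖kTransform (μ j) w - kTransform (μ j) w'‖ ≤ 1 / (2 * (N + 1)) * ‖w - w'‖ :=
    eventually_all.2 fun j => eventually_norm_kTransform_sub_le (μ j) zero_le_two hη
  filter_upwards [h1, eventually_gt_atTop 0,
    eventually_norm_kTransform_approx_le μ one_pos le_rfl] with b hb hb0 hle m
  simp only [one_mul] at hle
  induction m with
  | zero =>
    intro k l _ _ T T' _ z hz
    refine (norm_sub_le _ _).trans ?_
    linarith [hle k T z hz, hle l T' z hz]
  | succ m ih =>
    intro k l hk hl T T' hTT' z hz
    obtain ⟨k, rfl⟩ := Nat.exists_eq_succ_of_ne_zero (by omega : k ≠ 0)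
    obtain ⟨l, rfl⟩ := Nat.exists_eq_succ_of_ne_zero (by omega : l ≠ 0)
    have hz0 := hb0.trans_le hz.2
    rw [Nat.succ_eq_add_one, Nat.succ_eq_add_one, kTransform_approx_succ μ k T hz0,
      kTransform_approx_succ μ l T' hz0, ← Finset.sum_sub_distrib]
    have hterm : ∀ j ∈ (Finset.univ : Finset (Fin N)), ‖((if hj : [j] ∈ T.verts then
        kTransform (μ j) (z - kTransform (approx μ k (T.branch j hj)) z) else 0) -
        if hj : [j] ∈ T'.verts then
        kTransform (μ j) (z - kTransform (approx μ l (T'.branch j hj)) z) else 0 : ℂ)‖ ≤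
        1 / (2 * (N + 1)) * ((1 / 2) ^ m * (2 * z.im)) := by
      intro j _
      have hiff : [j] ∈ T.verts ↔ [j] ∈ T'.verts := RootedTree.ball_eq_iff.1 hTT' _ (by simp)
      by_cases hj : [j] ∈ T.verts
      · have hj' := hiff.1 hj
        rw [dif_pos hj, dif_pos hj']
        refine (hb j _ (sub_mem_truncCone hz (kTransform_im_nonpos _ hz0) (hle _ _ z hz)) _
          (sub_mem_truncCone hz (kTransform_im_nonpos _ hz0) (hle _ _ z hz))).trans ?_
        rw [sub_sub_sub_cancel_left, norm_sub_rev]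
        gcongr
        exact ih k l (by omega) (by omega) _ _ (RootedTree.ball_branch_eq hTT' hj hj') z hz
      · rw [dif_neg hj, dif_neg fun hj' => hj (hiff.2 hj'), sub_zero, norm_zero]
        positivity
    refine (norm_sum_le_of_le _ hterm).trans ?_
    rw [Finset.sum_const, Finset.card_univ, Fintype.card_fin, nsmul_eq_mul]
    calc (N : ℝ) * (1 / (2 * (N + 1)) * ((1 / 2) ^ m * (2 * z.im))) =
          (N / (N + 1)) * ((1 / 2) ^ (m + 1) * (2 * z.im)) := by
          rw [pow_succ]
          field_simp
      _ ≤ (1 / 2) ^ (m + 1) * (2 * z.im) := mul_le_of_le_one_left (by positivity)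
          ((div_le_one (by positivity)).2 (by linarith))

theorem ofReal_mul_I_mem_truncCone {b : ℝ} (hb : 0 < b) : (b : ℂ) * I ∈ truncCone 1 b :=
  ⟨by simpa using hb.le, by simp⟩

theorem exists_tendsto_approx (μ : Fin N → ProbabilityMeasure ℝ) (T : RootedTree N) :
    ∃ ν, Tendsto (fun n => approx μ n T) atTop (𝓝 ν) := by
  obtain ⟨b, hb, hb0⟩ :=
    ((eventually_norm_kTransform_approx_sub_le μ).and (eventually_gt_atTop 0)).exists
  refine exists_tendsto_of_tendsto_kTransform (isTightMeasureSet_of_kTransform fun δ hδ => ?_)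
    (z₀ := ((2 * b : ℝ) : ℂ) * I) (by simpa using hb0) ?_
  · obtain ⟨y, hy, hy0⟩ := ((eventually_norm_kTransform_approx_le μ (lt_min hδ one_pos)
      (min_le_right δ 1)).and (eventually_gt_atTop 0)).exists
    refine ⟨y, hy0, fun n => (hy n T _ (ofReal_mul_I_mem_truncCone hy0)).trans ?_⟩
    rw [im_ofReal_mul, I_im, mul_one]
    exact mul_le_mul_of_nonneg_right (min_le_left _ _) hy0.le
  · filter_upwards [truncCone_mem_nhds hb0] with z hz
    refine cauchySeq_tendsto_of_complete (cauchySeq_of_le_tendsto_0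
      (fun m : ℕ => (1 / 2 : ℝ) ^ m * (2 * z.im)) (fun k l m hk hl => ?_) ?_)
    · rw [dist_eq_norm]
      exact hb m k l hk hl T T rfl z hz
    · simpa using (tendsto_pow_atTop_nhds_zero_of_lt_one (by norm_num : (0 : ℝ) ≤ 1 / 2)
        (by norm_num)).mul_const (2 * z.im)

theorem exists_isTreeConvolution (N : ℕ) :
    ∃ conv : RootedTree N → (Fin N → ProbabilityMeasure ℝ) → ProbabilityMeasure ℝ,
      IsTreeConvolution conv := by
  classical
  choose conv hconv using fun (T : RootedTree N) (μ : Fin N → ProbabilityMeasure ℝ) =>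
    exists_tendsto_approx μ T
  have hK : ∀ T μ, ∀ z : ℂ, 0 < z.im →
      Tendsto (fun n => kTransform (approx μ n T) z) atTop (𝓝 (kTransform (conv T μ) z)) :=
    fun T μ z hz => ((continuous_kTransform_measure hz).tendsto _).comp (hconv T μ)
  refine ⟨conv, fun μ => continuous_iff_continuousAt.2 fun T => ?_, fun T μ z hz => ?_⟩
  · obtain ⟨b, hb, hb0⟩ :=
      ((eventually_norm_kTransform_approx_sub_le μ).and (eventually_gt_atTop 0)).exists
    refine tendsto_of_tendsto_kTransform (isTightMeasureSet_of_kTransform fun δ hδ => ?_)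
      (z₀ := ((2 * b : ℝ) : ℂ) * I) (by simpa using hb0) ?_
    · obtain ⟨y, hy, hy0⟩ := ((eventually_norm_kTransform_approx_le μ (lt_min hδ one_pos)
        (min_le_right δ 1)).and (eventually_gt_atTop 0)).exists
      refine ⟨y, hy0, fun T' => ?_⟩
      have him : ((y : ℂ) * I).im = y := by simp
      refine le_of_tendsto (hK T' μ _ (by rw [him]; exact hy0)).norm
        (Eventually.of_forall fun n => (hy n T' _ (ofReal_mul_I_mem_truncCone hy0)).trans ?_)
      rw [him]
      exact mul_le_mul_of_nonneg_right (min_le_left _ _) hy0.le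
    · filter_upwards [truncCone_mem_nhds hb0] with z hz
      have hz0 := hb0.trans_le hz.2
      have hpow : Tendsto (fun m : ℕ => (1 / 2 : ℝ) ^ m * (2 * z.im)) atTop (𝓝 0) := by
        simpa using (tendsto_pow_atTop_nhds_zero_of_lt_one (by norm_num : (0 : ℝ) ≤ 1 / 2)
          (by norm_num)).mul_const (2 * z.im)
      rw [Metric.tendsto_nhds]
      intro ε hε
      obtain ⟨m, hm⟩ := (hpow.eventually_lt_const hε).exists
      filter_upwards [T.eventually_ball_eq m] with T' hT'
      rw [dist_eq_norm]
      -- The contraction bound is uniform in the depth `n ≥ m`, so it passes to the limit measures.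
      refine lt_of_le_of_lt (le_of_tendsto ((hK T' μ z hz0).sub (hK T μ z hz0)).norm ?_) hm
      filter_upwards [eventually_ge_atTop m] with n hn using hb m n n hn hn T' T hT' z hz
  -- The recursion from depth `n` to `n + 1` passes to the limit because each `K_{μ_j}` is
  -- continuous at the limiting argument.
  · refine tendsto_nhds_unique ((tendsto_add_atTop_iff_nat 1).2 (hK T μ z hz)) ?_
    simp_rw [kTransform_approx_succ μ _ T hz]
    refine tendsto_finsetSum _ fun j _ => ?_
    by_cases hj : [j] ∈ T.verts
    · simp only [dif_pos hj]
      have hpos := hz.trans_le (im_le_im_sub_kTransform (conv (T.branch j hj) μ) hz)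
      exact (differentiableAt_kTransform (μ j) hpos).continuousAt.tendsto.comp
        ((hK (T.branch j hj) μ z hz).const_sub z)
    · simp only [dif_neg hj]
      exact tendsto_const_nhds

theorem isTreeConvolution_treeConv (N : ℕ) : IsTreeConvolution (treeConv (N := N)) :=
  Classical.epsilon_spec (exists_isTreeConvolution N)

end Existence

theorem RootedTree.compatible_perm {N : ℕ} (T : RootedTree N) (σ : Equiv.Perm (Fin N)) :
    T.Compatible (σ⁻¹ : Equiv.Perm (Fin N)) where
  alternating s hs := by
    unfold IsAlternating
    rw [List.isChain_map]
    exact (T.alternating s hs).imp fun a b hab => (σ⁻¹ : Equiv.Perm (Fin N)).injective.ne hab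
  injOn := (List.map_injective_iff.2 (σ⁻¹ : Equiv.Perm (Fin N)).injective).injOn

end TreeConvolution
end

theorem proposition5p1 :
    -- the convolution is well defined for every `N`
    (∀ N : ℕ, ∃! conv : TreeConvolution.RootedTree N →
        (Fin N → MeasureTheory.ProbabilityMeasure ℝ) → MeasureTheory.ProbabilityMeasure ℝ,
      TreeConvolution.IsTreeConvolution conv) ∧
    -- the convolution identity
    (∀ (N N' : ℕ) (ψ : Fin N → Fin N'), Function.Surjective ψ →
      ∀ (T : TreeConvolution.RootedTree N) (hT : T.Compatible ψ)
        (μ : Fin N' → MeasureTheory.ProbabilityMeasure ℝ),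
        TreeConvolution.treeConv T (fun j => μ (ψ j)) =
          TreeConvolution.treeConv (T.map ψ hT.alternating) μ) ∧
    -- permutation-equivariance
    (∀ (N : ℕ) (σ : Equiv.Perm (Fin N)) (T : TreeConvolution.RootedTree N)
        (μ : Fin N → MeasureTheory.ProbabilityMeasure ℝ),
        TreeConvolution.treeConv (T.perm σ) (fun j => μ (σ j)) =
          TreeConvolution.treeConv T μ) := by
  refine ⟨fun N => ?_, fun N N' ψ _ T hT μ => ?_, fun N σ T μ => ?_⟩
  · obtain ⟨conv, hconv⟩ := TreeConvolution.exists_isTreeConvolution N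
    exact ⟨conv, hconv, fun conv' hconv' => hconv'.unique hconv⟩
  · exact (TreeConvolution.isTreeConvolution_treeConv N).map_eq
      (TreeConvolution.isTreeConvolution_treeConv N') ψ T hT μ
  -- Taking `ψ = σ⁻¹` with the permuted family `μ ∘ σ` restores `μ` on the side of `T`.
  · have h := (TreeConvolution.isTreeConvolution_treeConv N).map_eq
      (TreeConvolution.isTreeConvolution_treeConv N) (σ⁻¹ : Equiv.Perm (Fin N)) T
      (T.compatible_perm σ) (fun j => μ (σ j))
    have hμ : (fun j => μ (σ ((σ⁻¹ : Equiv.Perm (Fin N)) j))) = μ := by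
      funext j
      simp
    rw [hμ] at h
    exact h.symm
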